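/- Let $A=(a_{ij})$ be an $n\times n$ alternating sign matrix (entries in $\{-1,0,1\}$, the nonzero entries of each row and column alternate in sign, each row and column sums to $1$), with corner sums $r_A(i,j)=\sum_{k\le i,\,l\le j}a_{kl}$. Order alternating sign matrices by $A\le B$ iff $r_A(i,j)\ge r_B(i,j)$ for all $i,j$; identify $w\in S_n$ with the matrix having ones in the positions $(i,w(i))$, and identify $A$ with the block diagonal matrices $A\oplus I_m$, so that elements of $S_{2n}$ can be compared with $A$. Let $\ell$ be the number of inversions, let $\mathrm{Perm}(A)$ be the set of minimal elements of $\{w\in S_n: w\ge A\}$, let $\deg(A)=\min\{\ell(w):w\in S_n,\ w\ge A\}$, and let $\mathrm{MinPerm}(A)=\{w\in \mathrm{Perm}(A):\ell(w)=\deg(A)\}$. Let $\mathfrak S_w$, $w\in S_n$, be the Schubert polynomials: $\mathfrak S_{w_0}=x_1^{n-1}x_2^{n-2}\cdots x_{n-1}$ for the longest element $w_0$ of $S_n$, and $\mathfrak S_{w}=\partial_k\mathfrak S_{ws_k}$ whenever $w(k)<w(k+1)$, where $s_k=(k,k+1)$, permutations are composed as functions, and $\partial_k f=(f-s_kf)/(x_k-x_{k+1})$.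 Label the box $(i,j)$ of the $n\times n$ grid by the simple transposition $s_{i+j-1}\in S_{2n}$. For a set $P$ of boxes, let $\delta(P)\in S_{2n}$ be the Demazure product of the word obtained by reading the labels of the boxes of $P$ along rows from right to left, from the top row to the bottom row: start with the identity and, for each letter $s$ in turn, replace the current $w$ by $ws$ if $\ell(ws)>\ell(w)$ and keep $w$ otherwise. For a set $P$ of boxes let $\mathcal F_P$ be its complement in the grid, and let $\Delta_A$ be the simplicial complex $\{\mathcal F_P:\delta(P)\ge A\}$. Let $F(\Delta_A)$ be the set of its facets (inclusion-maximal faces) and $F_{\max}(\Delta_A)$ the set of its faces of maximal dimension. Put $\mathrm{wt}(\mathcal F_P)=\prod_{i=1}^n x_i^{n_i}$ with $n_i=|\{j:(i,j)\in P\}|$. Then $$\sum_{w\in \mathrm{Perm}(A)}\mathfrak S_w=\sum_{\mathcal F_P\in F(\Delta_A)}\mathrm{wt}(\mathcal F_P)\qquad\text{and}\qquad \sum_{w\in \mathrm{MinPerm}(A)}\mathfrak S_w=\sum_{\mathcal F_P\in F_{\max}(\Delta_A)}\mathrm{wt}(\mathcal F_P).$$ -/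

import Mathlib

namespace AsmSchubert


/-! ### Alternating sign matrices and their order -/

/-- A finite sequence of integers with entries in `{-1, 0, 1}`, whose nonzero entries alternate in
sign (two nonzero entries with only zeros between them have opposite signs), and with sum `1`. -/
def IsAlternatingLine {n : ℕ} (v : Fin n → ℤ) : Prop :=
  (∀ j, v j = -1 ∨ v j = 0 ∨ v j = 1) ∧
  (∀ j j', j < j' → v j ≠ 0 → v j' ≠ 0 → (∀ k, j < k → k < j' → v k = 0) → v j' = -v j) ∧
  ∑ j, v j = 1

/-- Alternating sign matrices: all rows and all columns are alternating lines. -/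
def IsASM {n : ℕ} (A : Matrix (Fin n) (Fin n) ℤ) : Prop :=
  (∀ i, IsAlternatingLine fun j => A i j) ∧ (∀ j, IsAlternatingLine fun i => A i j)

/-- The corner sum function `r_A(i, j) = ∑_{k ≤ i} ∑_{l ≤ j} a_{kl}`. -/
def cornerSum {n : ℕ} (A : Matrix (Fin n) (Fin n) ℤ) (i j : Fin n) : ℤ :=
  ∑ k ∈ Finset.Iic i, ∑ l ∈ Finset.Iic j, A k l

/-- The order on alternating sign matrices: `A ≤ B` iff `r_A ≥ r_B` entrywise. -/
def AsmLE {n : ℕ} (A B : Matrix (Fin n) (Fin n) ℤ) : Prop :=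
  ∀ i j, cornerSum B i j ≤ cornerSum A i j

/-- The permutation matrix of `w`, with a one in each of the positions `(i, w i)`. -/
def permMat {n : ℕ} (w : Equiv.Perm (Fin n)) : Matrix (Fin n) (Fin n) ℤ :=
  fun i j => if w i = j then 1 else 0

/-- The inclusion `ASM(n) → ASM(2n)`, sending `A` to the block diagonal matrix with blocks `A` and
the identity matrix (the `n`-fold iterate of `ASM(m) → ASM(m + 1)`). -/
def stabilize {n : ℕ} (A : Matrix (Fin n) (Fin n) ℤ) : Matrix (Fin (n + n)) (Fin (n + n)) ℤ :=
  Matrix.reindex finSumFinEquiv finSumFinEquiv (Matrix.fromBlocks A 0 0 1)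

/-! ### Permutations -/

/-- The length of a permutation: its number of inversions. -/
def permLength {N : ℕ} (w : Equiv.Perm (Fin N)) : ℕ :=
  (Finset.univ.filter fun p : Fin N × Fin N => p.1 < p.2 ∧ w p.2 < w p.1).card

/-- The simple transposition exchanging the `0`-based indices `k` and `k + 1`. -/
def simpleRefl {N : ℕ} (k : ℕ) (hk : k + 1 < N) : Equiv.Perm (Fin N) :=
  Equiv.swap ⟨k, by omega⟩ ⟨k + 1, hk⟩

open scoped Classical in
/-- `{w ∈ S_n : w ≥ A}`. -/
noncomputable def permsAbove {n : ℕ} (A : Matrix (Fin n) (Fin n) ℤ) :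
    Finset (Equiv.Perm (Fin n)) :=
  Finset.univ.filter fun w => AsmLE A (permMat w)

open scoped Classical in
/-- `Perm(A)`: the minimal elements of `{w ∈ S_n : w ≥ A}`. -/
noncomputable def permSet {n : ℕ} (A : Matrix (Fin n) (Fin n) ℤ) :
    Finset (Equiv.Perm (Fin n)) :=
  (permsAbove A).filter fun w => ∀ v ∈ permsAbove A, AsmLE (permMat v) (permMat w) → v = w

/-- `deg(A)`: the least length of a permutation `w ∈ S_n` with `w ≥ A`. -/
noncomputable def asmDeg {n : ℕ} (A : Matrix (Fin n) (Fin n) ℤ) : ℕ :=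
  sInf {l : ℕ | ∃ w ∈ permsAbove A, permLength w = l}

/-- `MinPerm(A)`: the elements of `Perm(A)` of length `deg(A)`. -/
noncomputable def minPermSet {n : ℕ} (A : Matrix (Fin n) (Fin n) ℤ) :
    Finset (Equiv.Perm (Fin n)) :=
  (permSet A).filter fun w => permLength w = asmDeg A

/-! ### Schubert polynomials -/

theorem sub_dvd_sub_rename_swap {σ : Type*} [DecidableEq σ] (i j : σ) (f : MvPolynomial σ ℤ) :
    (MvPolynomial.X i - MvPolynomial.X j : MvPolynomial σ ℤ) ∣
      f - MvPolynomial.rename (Equiv.swap i j) f := by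
  induction f using MvPolynomial.induction_on with
  | C a => simp
  | add p q hp hq =>
    have h := dvd_add hp hq
    rw [map_add]
    convert h using 1
    ring
  | mul_X p k hp =>
    have hX : (MvPolynomial.X i - MvPolynomial.X j : MvPolynomial σ ℤ) ∣
        MvPolynomial.X k - MvPolynomial.X (Equiv.swap i j k) := by
      rcases eq_or_ne k i with rfl | hki
      · simp
      · rcases eq_or_ne k j with rfl | hkj
        · rw [Equiv.swap_apply_right, ← neg_sub]
          exact neg_dvd.2 dvd_rfl
        · simp [Equiv.swap_apply_of_ne_of_ne hki hkj]
    have h := dvd_add (Dvd.dvd.mul_left hX p)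
      (Dvd.dvd.mul_right hp (MvPolynomial.X (Equiv.swap i j k)))
    rw [map_mul, MvPolynomial.rename_X]
    convert h using 1
    ring

/-- The divided difference `(f - s f) / (x_i - x_j)`, where `s` exchanges the variables `x_i` and
`x_j` (with `i ≠ j`): the quotient of an exact division in `ℤ[x]`. -/
noncomputable def dividedDiff {σ : Type*} [DecidableEq σ] (i j : σ) (f : MvPolynomial σ ℤ) :
    MvPolynomial σ ℤ :=
  (sub_dvd_sub_rename_swap i j f).choose

theorem dividedDiff_spec {σ : Type*} [DecidableEq σ] (i j : σ) (f : MvPolynomial σ ℤ) :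
    f - MvPolynomial.rename (Equiv.swap i j) f =
      (MvPolynomial.X i - MvPolynomial.X j) * dividedDiff i j f :=
  (sub_dvd_sub_rename_swap i j f).choose_spec

theorem toLex_lt_mul_simpleRefl {n : ℕ} (w : Equiv.Perm (Fin n)) (k : ℕ) (hk : k + 1 < n)
    (h : w ⟨k, by omega⟩ < w ⟨k + 1, hk⟩) :
    toLex (⇑w) < toLex (⇑(w * simpleRefl k hk)) := by
  refine ⟨⟨k, by omega⟩, fun j hj => ?_, ?_⟩
  · have h1 : j ≠ ⟨k, by omega⟩ := ne_of_lt hj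
    have h2 : j ≠ ⟨k + 1, hk⟩ := by
      rintro rfl
      simp [Fin.lt_def] at hj
    simp [simpleRefl, Equiv.swap_apply_of_ne_of_ne h1 h2]
  · simpa [simpleRefl] using h

open scoped Classical in
/-- The Schubert polynomial `𝔖_w ∈ ℤ[x_1, …, x_n]` of `w ∈ S_n` (the variable `x_{i+1}` is
`X i`).  If `w` is the longest element, that is if it has no ascent, then
`𝔖_w = x_1^{n-1} x_2^{n-2} ⋯ x_{n-1}`.  Otherwise `𝔖_w = ∂_k 𝔖_{w s_k}` for an ascent
`w(k) < w(k+1)` (by the braid relations for the `∂_k` every choice of ascents gives the same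
polynomial). -/
noncomputable def schubert {n : ℕ} (w : Equiv.Perm (Fin n)) : MvPolynomial (Fin n) ℤ :=
  if h : ∃ k : ℕ, ∃ hk : k + 1 < n, w ⟨k, by omega⟩ < w ⟨k + 1, hk⟩ then
    dividedDiff ⟨h.choose, by have := h.choose_spec.1; omega⟩
      ⟨h.choose + 1, h.choose_spec.1⟩
      (schubert (w * simpleRefl h.choose h.choose_spec.1))
  else ∏ i : Fin n, MvPolynomial.X i ^ (n - 1 - (i : ℕ))
termination_by (wellFounded_gt (α := Lex (Fin n → Fin n))).wrap (toLex ⇑w)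
decreasing_by
  exact toLex_lt_mul_simpleRefl w _ _ h.choose_spec.2

/-! ### The square word and the complex `Δ_A` -/

/-- The Demazure product of a word in simple transpositions: starting from the identity and reading
the word from left to right, `w` is replaced by `w s` if this increases the length, and is kept
otherwise. -/
def demazure {N : ℕ} (Q : List (Equiv.Perm (Fin N))) : Equiv.Perm (Fin N) :=
  Q.foldl (fun w s => if permLength w < permLength (w * s) then w * s else w) 1

/-- The boxes of the `n × n` grid, read along rows from right to left, starting with the top row
and working down. -/
def readingOrder (n : ℕ) : List (Fin n × Fin n) :=
  (List.finRange n).flatMap fun i => (List.finRange n).reverse.map fun j => (i, j)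

/-- The letter of the square word in a given box: `s_{i+j-1} ∈ S_{2n}` in row `i` and column `j`,
counted from `1` (so that it exchanges the `0`-based indices `i + j` and `i + j + 1` if rows and
columns are counted from `0`). -/
def cellLetter {n : ℕ} (c : Fin n × Fin n) : Equiv.Perm (Fin (n + n)) :=
  simpleRefl ((c.1 : ℕ) + (c.2 : ℕ)) (by have := c.1.isLt; have := c.2.isLt; omega)

/-- The subword of the square word
`s_n ⋯ s_1  s_{n+1} ⋯ s_2  ⋯  s_{2n-1} ⋯ s_n` whose letters are in the boxes of `P`. -/
def subword {n : ℕ} (P : Finset (Fin n × Fin n)) : List (Equiv.Perm (Fin (n + n))) :=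
  ((readingOrder n).filter fun c => c ∈ P).map cellLetter

open scoped Classical in
/-- The complex `Δ_A`: its faces are the complements `F = Pᶜ` of the subwords `P` of the square
word whose Demazure product is `≥ A`. -/
noncomputable def asmComplex {n : ℕ} (A : Matrix (Fin n) (Fin n) ℤ) :
    Finset (Finset (Fin n × Fin n)) :=
  Finset.univ.filter fun F => AsmLE (stabilize A) (permMat (demazure (subword Fᶜ)))

open scoped Classical in
/-- The facets of a complex: its faces that are maximal with respect to inclusion. -/
noncomputable def facets {α : Type*} (Δ : Finset (Finset α)) : Finset (Finset α) :=
  Δ.filter fun F => ∀ G ∈ Δ, F ⊆ G → F = G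

/-- The dimension of a face. -/
def faceDim {α : Type*} (F : Finset α) : ℤ := (F.card : ℤ) - 1

/-- The dimension of a complex: the largest dimension of a face. -/
def complexDim {α : Type*} (Δ : Finset (Finset α)) : ℤ := ((Δ.sup Finset.card : ℕ) : ℤ) - 1

/-- The faces of codimension `dim Δ - dim F = 0`. -/
noncomputable def maxFacets {α : Type*} (Δ : Finset (Finset α)) : Finset (Finset α) :=
  Δ.filter fun F => complexDim Δ - faceDim F = 0

/-- The weight of the face `F = Pᶜ`: the product of the `x_i ^ n_i`, where `n_i` is the number of
boxes of `P` in row `i`. -/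
noncomputable def faceWeight {n : ℕ} (F : Finset (Fin n × Fin n)) : MvPolynomial (Fin n) ℤ :=
  ∏ i : Fin n, MvPolynomial.X i ^ (Finset.univ.filter fun j : Fin n => (i, j) ∈ Fᶜ).card

end AsmSchubert

open AsmSchubert

/-! Two facts combine. The facets of `Δ_A` are the complements of the box sets that spell a reduced
word of some `v ∈ Perm(A)`, and `𝔖_v` is the weighted sum over all box sets that spell a reduced
word of `v` (the pipe dream formula). A box set spells at most one permutation, so summing over
`Perm(A)` or `MinPerm(A)` gives the two identities.

Facets. The order is tested on corner sums, where smaller permutations have larger rank functions. A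
Demazure step by `s_k` replaces row `k + 1` of the rank function by the smallest row compatible with
its neighbours (`rowInf`); `rowSup` takes the largest one, and the two are adjoint for the order.
The adjunction gives the subword property (`exists_sublist_demWord_eq`) and shows that letters
outside `S_n` do not affect comparison with a stabilized `A` (`IsASM.asmLE_demWord_iff`), so
everything takes place in `S_n`. A box set minimal among those with product above `A` must then be a
reduced word of a minimal permutation (`IsASM.mem_facets_iff`).

Pipe dreams, following Fomin and Stanley. Reduced subwords are enumerated by a product of factors `1
+ x_i u_{i+j}` in the nilCoxeter algebra, acting on functions on `S_n`. Row products with the same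
range of indices commute (`NilCoxeterRel.rowProd_comm`), so the whole product is `H (1 - x_{k+1}
u_k)` with `H` symmetric in `x_k` and `x_{k+1}`; this is the divided difference recursion
(`pipeSum_sub_rename`). At the longest element only the staircase contributes. The recursion also
forces `pipeSum v ≠ 0`, so every `v` has a reduced word in the square; this serves both the longest
element and the faces of maximal dimension. -/

namespace AsmSchubert

/-! ### Rank functions -/

/-- The corner sums of `A` over the first `i` rows and the first `j` columns. -/
def rankFn {N : ℕ} (A : Matrix (Fin N) (Fin N) ℤ) (i j : ℕ) : ℤ :=
  ∑ a : Fin N, ∑ b : Fin N, if (a : ℕ) < i ∧ (b : ℕ) < j then A a b else 0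

/-- `r` dominates `r'` on the grid `{0, …, N} × {0, …, N}`. -/
def Dominates (N : ℕ) (r r' : ℕ → ℕ → ℤ) : Prop :=
  ∀ i ≤ N, ∀ j ≤ N, r' i j ≤ r i j

theorem Dominates.refl {N : ℕ} (r : ℕ → ℕ → ℤ) : Dominates N r r := fun _ _ _ _ => le_rfl

theorem Dominates.trans {N : ℕ} {r r' r'' : ℕ → ℕ → ℤ} (h : Dominates N r r')
    (h' : Dominates N r' r'') : Dominates N r r'' :=
  fun i hi j hj => (h' i hi j hj).trans (h i hi j hj)

section RankFn

variable {N : ℕ}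

theorem cornerSum_eq_rankFn (A : Matrix (Fin N) (Fin N) ℤ) (i j : Fin N) :
    cornerSum A i j = rankFn A (i + 1) (j + 1) := by
  classical
  unfold cornerSum rankFn
  have h1 : Finset.Iic i = Finset.univ.filter fun a : Fin N => (a : ℕ) < i + 1 := by
    ext a
    rw [Finset.mem_Iic, Finset.mem_filter, Fin.le_def, Nat.lt_succ_iff]
    simp
  have h2 : Finset.Iic j = Finset.univ.filter fun a : Fin N => (a : ℕ) < j + 1 := by
    ext a
    rw [Finset.mem_Iic, Finset.mem_filter, Fin.le_def, Nat.lt_succ_iff]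
    simp
  rw [h1, h2, Finset.sum_filter]
  refine Finset.sum_congr rfl fun a _ => ?_
  rw [Finset.sum_filter]
  split_ifs with h <;> simp [h]

@[simp] theorem rankFn_zero_left (A : Matrix (Fin N) (Fin N) ℤ) (j : ℕ) : rankFn A 0 j = 0 := by
  simp [rankFn]

@[simp] theorem rankFn_zero_right (A : Matrix (Fin N) (Fin N) ℤ) (i : ℕ) : rankFn A i 0 = 0 := by
  simp [rankFn]

theorem rankFn_min (A : Matrix (Fin N) (Fin N) ℤ) (i j : ℕ) :
    rankFn A (min i N) (min j N) = rankFn A i j := by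
  unfold rankFn
  refine Finset.sum_congr rfl fun a _ => Finset.sum_congr rfl fun b _ => ?_
  have ha := a.isLt
  have hb := b.isLt
  congr 1
  apply propext
  omega

theorem asmLE_iff_dominates (A B : Matrix (Fin N) (Fin N) ℤ) :
    AsmLE A B ↔ Dominates N (rankFn A) (rankFn B) := by
  constructor
  · intro h i hi j hj
    rcases i with _ | i
    · simp
    rcases j with _ | j
    · simp
    simpa only [cornerSum_eq_rankFn] using h ⟨i, hi⟩ ⟨j, hj⟩
  · intro h i j
    simpa only [cornerSum_eq_rankFn] using h (i + 1) i.isLt (j + 1) j.isLt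

theorem rankFn_succ (A : Matrix (Fin N) (Fin N) ℤ) {i : ℕ} (hi : i < N) (j : ℕ) :
    rankFn A (i + 1) j = rankFn A i j + ∑ b : Fin N, if (b : ℕ) < j then A ⟨i, hi⟩ b else 0 := by
  classical
  have h : ∀ a : Fin N, (∑ b : Fin N, if (a : ℕ) < i + 1 ∧ (b : ℕ) < j then A a b else 0) =
      (∑ b : Fin N, if (a : ℕ) < i ∧ (b : ℕ) < j then A a b else 0) +
      if a = ⟨i, hi⟩ then (∑ b : Fin N, if (b : ℕ) < j then A a b else 0) else 0 := by
    intro a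
    rcases lt_trichotomy (a : ℕ) i with h | h | h
    · simp [h, h.trans (Nat.lt_succ_self i), Fin.ext_iff, h.ne]
    · simp [h, Fin.ext_iff]
    · simp [Fin.ext_iff, h.ne', not_lt.2 h.le, not_lt.2 (Nat.succ_le_of_lt h)]
  unfold rankFn
  rw [Finset.sum_congr rfl fun a _ => h a, Finset.sum_add_distrib]
  simp

theorem rankFn_permMat_succ (w : Equiv.Perm (Fin N)) {i : ℕ} (hi : i < N) (j : ℕ) :
    rankFn (permMat w) (i + 1) j =
      rankFn (permMat w) i j + if (w ⟨i, hi⟩ : ℕ) < j then 1 else 0 := by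
  rw [rankFn_succ _ hi]
  congr 1
  rw [Finset.sum_eq_single (w ⟨i, hi⟩)] <;> simp +contextual [permMat, eq_comm]

theorem rankFn_permMat (w : Equiv.Perm (Fin N)) (i j : ℕ) :
    rankFn (permMat w) i j = ∑ a : Fin N, if (a : ℕ) < i ∧ (w a : ℕ) < j then 1 else 0 := by
  unfold rankFn
  refine Finset.sum_congr rfl fun a _ => ?_
  rw [Finset.sum_eq_single (w a)] <;> simp +contextual [permMat, eq_comm]

theorem rankFn_permMat_step (w : Equiv.Perm (Fin N)) (i j : ℕ) (hi : i < N) :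
    rankFn (permMat w) i j ≤ rankFn (permMat w) (i + 1) j ∧
      rankFn (permMat w) (i + 1) j ≤ rankFn (permMat w) i j + 1 := by
  rw [rankFn_permMat_succ w hi]
  split_ifs <;> simp

theorem rankFn_permMat_one {i j : ℕ} (hi : i ≤ N) :
    rankFn (permMat (1 : Equiv.Perm (Fin N))) i j = min i j := by
  induction i with
  | zero => simp
  | succ i ih =>
    rw [rankFn_permMat_succ _ (by omega), ih (by omega)]
    simp only [Equiv.Perm.coe_one, id]
    split_ifs <;> omega

theorem rankFn_permMat_le_left (w : Equiv.Perm (Fin N)) {i : ℕ} (hi : i ≤ N) (j : ℕ) :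
    rankFn (permMat w) i j ≤ i := by
  induction i with
  | zero => simp
  | succ i ih =>
    have := (rankFn_permMat_step w i j (by omega)).2
    have := ih (by omega)
    push_cast
    omega

theorem rankFn_permMat_le_right (w : Equiv.Perm (Fin N)) {i : ℕ} (hi : i ≤ N) (j : ℕ) :
    rankFn (permMat w) i j ≤ j := by
  have h : rankFn (permMat w) N j = rankFn (permMat (1 : Equiv.Perm (Fin N))) N j := by
    rw [rankFn_permMat, rankFn_permMat]
    simp only [Fin.is_lt, true_and, Equiv.Perm.coe_one, id]
    exact Equiv.sum_comp w fun a => if (a : ℕ) < j then (1 : ℤ) else 0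
  have h2 : rankFn (permMat w) i j ≤ rankFn (permMat w) N j := by
    obtain ⟨d, rfl⟩ := Nat.exists_eq_add_of_le hi
    rw [rankFn_permMat, rankFn_permMat]
    refine Finset.sum_le_sum fun a _ => ?_
    have := a.isLt
    split_ifs <;> omega
  rw [h, rankFn_permMat_one le_rfl] at h2
  omega

theorem dominates_one (w : Equiv.Perm (Fin N)) :
    Dominates N (rankFn (permMat (1 : Equiv.Perm (Fin N)))) (rankFn (permMat w)) := by
  intro i hi j _
  rw [rankFn_permMat_one hi]
  have := rankFn_permMat_le_left w hi j
  have := rankFn_permMat_le_right w hi j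
  omega

/-- Consecutive rows of the rank function differ by the indicator of `w i < j`, so the rank function
determines the permutation. -/
theorem Dominates.antisymm {v w : Equiv.Perm (Fin N)}
    (h : Dominates N (rankFn (permMat v)) (rankFn (permMat w)))
    (h' : Dominates N (rankFn (permMat w)) (rankFn (permMat v))) : v = w := by
  ext ⟨i, hi⟩
  have key : ∀ j ≤ N, ((v ⟨i, hi⟩ : ℕ) < j ↔ (w ⟨i, hi⟩ : ℕ) < j) := by
    intro j hj
    have h1 := h i hi.le j hj
    have h2 := h' i hi.le j hj
    have h3 := h (i + 1) hi j hj
    have h4 := h' (i + 1) hi j hj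
    rw [rankFn_permMat_succ _ hi, rankFn_permMat_succ _ hi] at h3 h4
    split_ifs at h3 h4 <;> omega
  have h1 := key (v ⟨i, hi⟩ + 1) (v ⟨i, hi⟩).isLt
  have h2 := key (w ⟨i, hi⟩ + 1) (w ⟨i, hi⟩).isLt
  omega

end RankFn

/-! ### Demazure steps -/

/-- Row `k + 1` of `r` is replaced by the smallest row allowed by the neighbouring rows. -/
def rowInf (k : ℕ) (r : ℕ → ℕ → ℤ) (i j : ℕ) : ℤ :=
  if i = k + 1 then max (r k j) (r (k + 2) j - 1) else r i j

/-- Row `k + 1` of `r` is replaced by the largest row allowed by the neighbouring rows. -/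
def rowSup (k : ℕ) (r : ℕ → ℕ → ℤ) (i j : ℕ) : ℤ :=
  if i = k + 1 then min (r k j + 1) (r (k + 2) j) else r i j

/-- `w` has an ascent in the positions `k`, `k + 1`. -/
def IsAscent {N : ℕ} (w : Equiv.Perm (Fin N)) (k : ℕ) : Prop :=
  ∃ hk : k + 1 < N, w ⟨k, by omega⟩ < w ⟨k + 1, hk⟩

/-- `w` has a descent in the positions `k`, `k + 1`. -/
def IsDescent {N : ℕ} (w : Equiv.Perm (Fin N)) (k : ℕ) : Prop :=
  ∃ hk : k + 1 < N, w ⟨k + 1, hk⟩ < w ⟨k, by omega⟩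

/-- The simple transposition with index `k`, and the identity if `k` is out of range. -/
def adjSwap (N k : ℕ) : Equiv.Perm (Fin N) :=
  if hk : k + 1 < N then simpleRefl k hk else 1

section AdjSwap

variable {N : ℕ}

theorem adjSwap_eq {k : ℕ} (hk : k + 1 < N) : adjSwap N k = simpleRefl k hk := dif_pos hk

theorem adjSwap_apply_left {k : ℕ} (hk : k + 1 < N) : adjSwap N k ⟨k, by omega⟩ = ⟨k + 1, hk⟩ := by
  rw [adjSwap_eq hk, simpleRefl, Equiv.swap_apply_left]

theorem adjSwap_apply_right {k : ℕ} (hk : k + 1 < N) : adjSwap N k ⟨k + 1, hk⟩ = ⟨k, by omega⟩ := by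
  rw [adjSwap_eq hk, simpleRefl, Equiv.swap_apply_right]

theorem adjSwap_apply_of_ne {k i : ℕ} (hi : i < N) (h1 : i ≠ k) (h2 : i ≠ k + 1) :
    adjSwap N k ⟨i, hi⟩ = ⟨i, hi⟩ := by
  unfold adjSwap
  split_ifs with hk
  · exact Equiv.swap_apply_of_ne_of_ne (by simpa using h1) (by simpa using h2)
  · rfl

@[simp] theorem adjSwap_mul_self (k : ℕ) : adjSwap N k * adjSwap N k = 1 := by
  unfold adjSwap
  split_ifs
  · exact Equiv.swap_mul_self _ _
  · simp

@[simp] theorem mul_adjSwap_mul_adjSwap (w : Equiv.Perm (Fin N)) (k : ℕ) :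
    w * adjSwap N k * adjSwap N k = w := by
  rw [mul_assoc, adjSwap_mul_self, mul_one]

theorem IsDescent.mul_adjSwap {w : Equiv.Perm (Fin N)} {k : ℕ} (h : IsDescent w k) :
    IsAscent (w * adjSwap N k) k := by
  obtain ⟨hk, h⟩ := h
  exact ⟨hk, by simpa [adjSwap_apply_left hk, adjSwap_apply_right hk] using h⟩

theorem IsAscent.mul_adjSwap {w : Equiv.Perm (Fin N)} {k : ℕ} (h : IsAscent w k) :
    IsDescent (w * adjSwap N k) k := by
  obtain ⟨hk, h⟩ := h
  exact ⟨hk, by simpa [adjSwap_apply_left hk, adjSwap_apply_right hk] using h⟩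

theorem IsAscent.not_isDescent {w : Equiv.Perm (Fin N)} {k : ℕ} (h : IsAscent w k) :
    ¬ IsDescent w k := fun h' => lt_asymm h.2 h'.2

theorem isAscent_or_isDescent (w : Equiv.Perm (Fin N)) {k : ℕ} (hk : k + 1 < N) :
    IsAscent w k ∨ IsDescent w k := by
  rcases lt_trichotomy (w ⟨k, by omega⟩) (w ⟨k + 1, hk⟩) with h | h | h
  · exact Or.inl ⟨hk, h⟩
  · simp at h
  · exact Or.inr ⟨hk, h⟩

/-- Applying `s_k` to both positions preserves the order of every pair except `(k, k + 1)`, so it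
matches the inversions of `w` with those of `w s_k` other than this new one. -/
theorem IsAscent.permLength_mul {w : Equiv.Perm (Fin N)} {k : ℕ} (h : IsAscent w k) :
    permLength (w * adjSwap N k) = permLength w + 1 := by
  classical
  obtain ⟨hk, h⟩ := h
  set a : Fin N := ⟨k, by omega⟩ with ha
  set b : Fin N := ⟨k + 1, hk⟩ with hb
  have hlt : ∀ p q : Fin N, (p, q) ≠ (a, b) → p < q → adjSwap N k p < adjSwap N k q := by
    intro p q hne hpq
    rcases p with ⟨p, hp⟩
    rcases q with ⟨q, hq⟩
    simp only [ha, hb, ne_eq, Prod.mk.injEq, Fin.mk.injEq, not_and, Fin.mk_lt_mk] at hne hpq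
    by_cases h1 : p = k
    · subst h1
      rw [adjSwap_apply_left hk, adjSwap_apply_of_ne hq (by omega) (by omega), Fin.mk_lt_mk]
      omega
    by_cases h2 : p = k + 1
    · subst h2
      rw [adjSwap_apply_right hk, adjSwap_apply_of_ne hq (by omega) (by omega), Fin.mk_lt_mk]
      omega
    rw [adjSwap_apply_of_ne hp h1 h2]
    by_cases h3 : q = k
    · subst h3
      rw [adjSwap_apply_left hk, Fin.mk_lt_mk]
      omega
    by_cases h4 : q = k + 1
    · subst h4
      rw [adjSwap_apply_right hk, Fin.mk_lt_mk]
      omega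
    rw [adjSwap_apply_of_ne hq h3 h4, Fin.mk_lt_mk]
    exact hpq
  have hab : adjSwap N k a = b := adjSwap_apply_left hk
  have hba : adjSwap N k b = a := adjSwap_apply_right hk
  have hrr : ∀ p, adjSwap N k (adjSwap N k p) = p := fun p => by
    rw [← Equiv.Perm.mul_apply, adjSwap_mul_self, Equiv.Perm.one_apply]
  have hab' : a < b := by simp [ha, hb]
  have hmem : (a, b) ∈ Finset.univ.filter fun p : Fin N × Fin N =>
      p.1 < p.2 ∧ (w * adjSwap N k) p.2 < (w * adjSwap N k) p.1 := by
    rw [Finset.mem_filter]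
    simpa [hab, hba, hab'] using h
  unfold permLength
  rw [← Finset.card_erase_add_one hmem]
  congr 1
  have hne : ∀ p q : Fin N, (p, q) ≠ (a, b) → p < q → (adjSwap N k p, adjSwap N k q) ≠ (a, b) := by
    intro p q _ hpq he
    rw [Prod.mk.injEq] at he
    have h1 := hrr p
    have h2 := hrr q
    rw [he.1, hab] at h1
    rw [he.2, hba] at h2
    subst h1 h2
    exact lt_asymm hpq hab'
  refine Finset.card_bij' (fun p _ => (adjSwap N k p.1, adjSwap N k p.2))
    (fun p _ => (adjSwap N k p.1, adjSwap N k p.2)) ?_ ?_ ?_ ?_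
  · rintro ⟨p, q⟩ hp
    rw [Finset.mem_erase, Finset.mem_filter] at hp
    rw [Finset.mem_filter]
    exact ⟨Finset.mem_univ _, hlt p q hp.1 hp.2.2.1, hp.2.2.2⟩
  · rintro ⟨p, q⟩ hp
    rw [Finset.mem_filter] at hp
    have hn : (p, q) ≠ (a, b) := by
      intro he
      rw [he] at hp
      exact lt_asymm hp.2.2 h
    rw [Finset.mem_erase, Finset.mem_filter]
    refine ⟨hne p q hn hp.2.1, Finset.mem_univ _, hlt p q hn hp.2.1, ?_⟩
    simpa only [Equiv.Perm.mul_apply, hrr] using hp.2.2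
  · rintro ⟨p, q⟩ _
    simp [hrr]
  · rintro ⟨p, q⟩ _
    simp [hrr]

theorem IsDescent.permLength_mul {w : Equiv.Perm (Fin N)} {k : ℕ} (h : IsDescent w k) :
    permLength (w * adjSwap N k) + 1 = permLength w := by
  rw [← h.mul_adjSwap.permLength_mul, mul_adjSwap_mul_adjSwap]

/-! ### Effect of a simple transposition on rank functions -/

theorem rankFn_mul_adjSwap (w : Equiv.Perm (Fin N)) {i k : ℕ} (hi : i ≠ k + 1) (j : ℕ) :
    rankFn (permMat (w * adjSwap N k)) i j = rankFn (permMat w) i j := by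
  rw [rankFn_permMat, rankFn_permMat, ← Equiv.sum_comp (adjSwap N k)]
  refine Finset.sum_congr rfl fun a _ => ?_
  rw [← Equiv.Perm.mul_apply, mul_adjSwap_mul_adjSwap]
  congr 1
  have : (adjSwap N k a : ℕ) < i ↔ (a : ℕ) < i := by
    by_cases hk : k + 1 < N
    · rcases a with ⟨a, ha⟩
      by_cases h1 : a = k
      · subst h1
        rw [adjSwap_apply_left hk]
        dsimp only
        omega
      by_cases h2 : a = k + 1
      · subst h2
        rw [adjSwap_apply_right hk]
        dsimp only
        omega
      rw [adjSwap_apply_of_ne ha h1 h2]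
    · simp [adjSwap, hk]
  rw [this]

/-- At an ascent, the increment from row `k` is at least that from row `k + 1`, so row `k + 1` is as
large as its neighbours allow. At a descent the inequality is reversed and the row is as small as
possible. -/
theorem IsAscent.rankFn_eq {w : Equiv.Perm (Fin N)} {k : ℕ} (h : IsAscent w k) :
    rankFn (permMat w) = rowSup k (rankFn (permMat w)) := by
  obtain ⟨hk, h⟩ := h
  funext i j
  unfold rowSup
  split_ifs with hi
  · subst hi
    rw [Fin.lt_def] at h
    rw [rankFn_permMat_succ w hk, rankFn_permMat_succ w (show k < N by omega)]
    split_ifs <;> omega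
  · rfl

theorem IsDescent.rankFn_eq {w : Equiv.Perm (Fin N)} {k : ℕ} (h : IsDescent w k) :
    rankFn (permMat w) = rowInf k (rankFn (permMat w)) := by
  obtain ⟨hk, h⟩ := h
  funext i j
  unfold rowInf
  split_ifs with hi
  · subst hi
    rw [Fin.lt_def] at h
    rw [rankFn_permMat_succ w hk, rankFn_permMat_succ w (show k < N by omega)]
    split_ifs <;> omega
  · rfl

theorem rowInf_congr {k : ℕ} {r r' : ℕ → ℕ → ℤ} (h : ∀ i ≠ k + 1, ∀ j, r i j = r' i j) :
    rowInf k r = rowInf k r' := by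
  funext i j
  unfold rowInf
  split_ifs with hi
  · rw [h _ (by omega), h _ (by omega)]
  · exact h i hi j

theorem rowSup_congr {k : ℕ} {r r' : ℕ → ℕ → ℤ} (h : ∀ i ≠ k + 1, ∀ j, r i j = r' i j) :
    rowSup k r = rowSup k r' := by
  funext i j
  unfold rowSup
  split_ifs with hi
  · rw [h _ (by omega), h _ (by omega)]
  · exact h i hi j

theorem IsDescent.rankFn_mul {w : Equiv.Perm (Fin N)} {k : ℕ} (h : IsDescent w k) :
    rankFn (permMat (w * adjSwap N k)) = rowSup k (rankFn (permMat w)) := by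
  rw [h.mul_adjSwap.rankFn_eq]
  exact rowSup_congr fun i hi j => rankFn_mul_adjSwap w hi j

theorem IsAscent.rankFn_mul {w : Equiv.Perm (Fin N)} {k : ℕ} (h : IsAscent w k) :
    rankFn (permMat (w * adjSwap N k)) = rowInf k (rankFn (permMat w)) := by
  rw [h.mul_adjSwap.rankFn_eq]
  exact rowInf_congr fun i hi j => rankFn_mul_adjSwap w hi j

/-- One step of the Demazure product. -/
def demStep (w : Equiv.Perm (Fin N)) (k : ℕ) : Equiv.Perm (Fin N) :=
  if permLength w < permLength (w * adjSwap N k) then w * adjSwap N k else w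

theorem IsAscent.demStep_eq {w : Equiv.Perm (Fin N)} {k : ℕ} (h : IsAscent w k) :
    demStep w k = w * adjSwap N k :=
  if_pos (by rw [h.permLength_mul]; omega)

theorem IsDescent.demStep_eq {w : Equiv.Perm (Fin N)} {k : ℕ} (h : IsDescent w k) :
    demStep w k = w :=
  if_neg (by rw [← h.permLength_mul]; omega)

theorem demStep_of_le (w : Equiv.Perm (Fin N)) {k : ℕ} (h : N ≤ k + 1) : demStep w k = w :=
  if_neg (by simp [adjSwap, not_lt.2 h])

/-- The two cases of a Demazure step become one operation: `rowInf` creates the descent at an ascent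
and fixes the rank function at a descent. Monotonicity in `w` is then visible from the formula. -/
theorem rankFn_demStep (w : Equiv.Perm (Fin N)) {k : ℕ} (hk : k + 1 < N) :
    rankFn (permMat (demStep w k)) = rowInf k (rankFn (permMat w)) := by
  rcases isAscent_or_isDescent w hk with h | h
  · rw [h.demStep_eq, h.rankFn_mul]
  · rw [h.demStep_eq, ← h.rankFn_eq]

theorem permLength_demStep_le (w : Equiv.Perm (Fin N)) (k : ℕ) :
    permLength (demStep w k) ≤ permLength w + 1 := by
  by_cases hk : k + 1 < N
  · rcases isAscent_or_isDescent w hk with h | h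
    · rw [h.demStep_eq, h.permLength_mul]
    · rw [h.demStep_eq]
      omega
  · rw [demStep_of_le w (not_lt.1 hk)]
    omega

theorem Dominates.rowInf_mono {r r' : ℕ → ℕ → ℤ} (h : Dominates N r r') {k : ℕ}
    (hk : k + 1 < N) : Dominates N (rowInf k r) (rowInf k r') := by
  intro i hi j hj
  unfold rowInf
  split_ifs
  · have := h k (by omega) j hj
    have := h (k + 2) (by omega) j hj
    omega
  · exact h i hi j hj

/-- The increments of `r` between consecutive rows are `0` or `1`. -/
def UnitSteps (N : ℕ) (r : ℕ → ℕ → ℤ) : Prop :=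
  ∀ i < N, ∀ j ≤ N, r i j ≤ r (i + 1) j ∧ r (i + 1) j ≤ r i j + 1

theorem unitSteps_permMat (w : Equiv.Perm (Fin N)) : UnitSteps N (rankFn (permMat w)) :=
  fun i hi j _ => rankFn_permMat_step w i j hi

/-- One half of the adjunction between `rowInf` and `rowSup`. Only rows `k` and `k + 2` of the
hypothesis matter for row `k + 1`, since unit steps bound `r' (k + 1) j` by `r' k j + 1` and by `r'
(k + 2) j`. -/
theorem Dominates.rowSup_of_rowInf {r r' : ℕ → ℕ → ℤ} {k : ℕ} (hr' : UnitSteps N r')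
    (hk : k + 1 < N) (h : Dominates N r (rowInf k r')) : Dominates N (rowSup k r) r' := by
  intro i hi j hj
  have h0 := h i hi j hj
  have h1 := h k (by omega) j hj
  have h2 := h (k + 2) (by omega) j hj
  have h3 := hr' k (by omega) j hj
  have h4 := hr' (k + 1) (by omega) j hj
  simp only [rowInf, rowSup] at *
  rw [if_neg (by omega)] at h1 h2
  by_cases h : i = k + 1
  · subst h
    rw [if_pos rfl] at h0 ⊢
    rw [show k + 2 = k + 1 + 1 from rfl] at *
    omega
  · rwa [if_neg h] at h0 ⊢

theorem Dominates.rowInf_of_rowSup {r r' : ℕ → ℕ → ℤ} {k : ℕ} (hr : UnitSteps N r)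
    (hk : k + 1 < N) (h : Dominates N (rowSup k r) r') : Dominates N r (rowInf k r') := by
  intro i hi j hj
  have h0 := h i hi j hj
  have h1 := h k (by omega) j hj
  have h2 := h (k + 2) (by omega) j hj
  have h3 := hr k (by omega) j hj
  have h4 := hr (k + 1) (by omega) j hj
  simp only [rowInf, rowSup] at *
  rw [if_neg (by omega)] at h1 h2
  by_cases h : i = k + 1
  · subst h
    rw [if_pos rfl] at h0 ⊢
    rw [show k + 2 = k + 1 + 1 from rfl] at *
    omega
  · rwa [if_neg h] at h0 ⊢

theorem dominates_demStep (w : Equiv.Perm (Fin N)) (k : ℕ) :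
    Dominates N (rankFn (permMat w)) (rankFn (permMat (demStep w k))) := by
  by_cases hk : k + 1 < N
  · rw [rankFn_demStep w hk]
    intro i hi j hj
    have h3 := rankFn_permMat_step w k j (by omega)
    have h4 := rankFn_permMat_step w (k + 1) j (by omega)
    unfold rowInf
    split_ifs with h
    · subst h
      rw [show k + 2 = k + 1 + 1 from rfl]
      omega
    · exact le_rfl
  · rw [demStep_of_le w (not_lt.1 hk)]
    exact Dominates.refl _

theorem Dominates.demStep_mono {v w : Equiv.Perm (Fin N)}
    (h : Dominates N (rankFn (permMat v)) (rankFn (permMat w))) (k : ℕ) :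
    Dominates N (rankFn (permMat (demStep v k))) (rankFn (permMat (demStep w k))) := by
  by_cases hk : k + 1 < N
  · rw [rankFn_demStep v hk, rankFn_demStep w hk]
    exact h.rowInf_mono hk
  · rwa [demStep_of_le v (not_lt.1 hk), demStep_of_le w (not_lt.1 hk)]

end AdjSwap

/-! ### Demazure products of words -/

/-- The Demazure product in `S_N` of the word with letters `s_k`, `k ∈ ks`; letters that are out
of range are ignored. -/
def demWord (N : ℕ) (ks : List ℕ) : Equiv.Perm (Fin N) :=
  ks.foldl demStep 1

section DemWord

variable {N : ℕ}

@[simp] theorem demWord_nil : demWord N [] = 1 := rfl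

theorem demWord_append_singleton (ks : List ℕ) (k : ℕ) :
    demWord N (ks ++ [k]) = demStep (demWord N ks) k := by
  simp [demWord]

@[simp] theorem permLength_one : permLength (1 : Equiv.Perm (Fin N)) = 0 := by
  simp only [permLength, Finset.card_eq_zero, Finset.filter_eq_empty_iff]
  rintro p - ⟨h1, h2⟩
  exact lt_asymm h1 h2

theorem permLength_demWord_le (ks : List ℕ) : permLength (demWord N ks) ≤ ks.length := by
  induction ks using List.reverseRecOn with
  | nil => simp
  | append_singleton ks k ih =>
    rw [demWord_append_singleton, List.length_append, List.length_singleton]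
    exact (permLength_demStep_le _ _).trans (by omega)

/-- A Demazure step moves up in the order and is monotone, so omitting letters can only lower the
product. The induction needs arbitrary comparable starting permutations. -/
theorem dominates_demWord_of_sublist {ks' ks : List ℕ} (h : List.Sublist ks' ks) :
    Dominates N (rankFn (permMat (demWord N ks'))) (rankFn (permMat (demWord N ks))) := by
  have key : ∀ v w : Equiv.Perm (Fin N), Dominates N (rankFn (permMat v)) (rankFn (permMat w)) →
      Dominates N (rankFn (permMat (ks'.foldl demStep v)))
        (rankFn (permMat (ks.foldl demStep w))) := by
    induction h with
    | slnil => exact fun v w h => h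
    | cons k _ ih => exact fun v w h => ih v _ (h.trans (dominates_demStep w k))
    | cons_cons k _ ih => exact fun v w h => ih _ _ (h.demStep_mono k)
  exact key 1 1 (Dominates.refl _)

/-- The subword property. -/
theorem exists_sublist_demWord_eq {α : Type*} (f : α → ℕ) (L : List α) (v : Equiv.Perm (Fin N))
    (h : Dominates N (rankFn (permMat v)) (rankFn (permMat (demWord N (L.map f))))) :
    ∃ L', List.Sublist L' L ∧ demWord N (L'.map f) = v ∧ L'.length = permLength v := by
  induction L using List.reverseRecOn generalizing v with
  | nil =>
    have hv : v = 1 := h.antisymm (dominates_one v)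
    subst hv
    exact ⟨[], List.Sublist.refl _, rfl, by simp⟩
  | append_singleton L a ih =>
    rw [List.map_append, List.map_singleton, demWord_append_singleton] at h
    by_cases hk : f a + 1 < N
    · rw [rankFn_demStep _ hk] at h
      -- By adjunction the last letter moves onto `v`: `rowSup` fixes the rank function of `v` at an
      -- ascent, so the letter is dropped, and yields that of `v s_k` at a descent, so the letter is
      -- used.
      have h' := Dominates.rowSup_of_rowInf (unitSteps_permMat _) hk h
      rcases isAscent_or_isDescent v hk with hv | hv
      · rw [← hv.rankFn_eq] at h'
        obtain ⟨L', h1, h2, h3⟩ := ih v h'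
        exact ⟨L', h1.trans (List.sublist_append_left _ _), h2, h3⟩
      · rw [← hv.rankFn_mul] at h'
        obtain ⟨L', h1, h2, h3⟩ := ih _ h'
        refine ⟨L' ++ [a], h1.append (List.Sublist.refl _), ?_, ?_⟩
        · rw [List.map_append, List.map_singleton, demWord_append_singleton, h2,
            hv.mul_adjSwap.demStep_eq, mul_adjSwap_mul_adjSwap]
        · rw [List.length_append, List.length_singleton, h3, hv.permLength_mul]
    · rw [demStep_of_le _ (not_lt.1 hk)] at h
      obtain ⟨L', h1, h2, h3⟩ := ih v h
      exact ⟨L', h1.trans (List.sublist_append_left _ _), h2, h3⟩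

theorem demWord_filter_lt (ks : List ℕ) :
    demWord N (ks.filter fun k => k + 1 < N) = demWord N ks := by
  induction ks using List.reverseRecOn with
  | nil => rfl
  | append_singleton ks k ih =>
    rw [List.filter_append, demWord_append_singleton, ← ih]
    by_cases hk : k + 1 < N
    · simp [hk, demWord_append_singleton]
    · simp [hk, demStep_of_le _ (not_lt.1 hk)]

/-- A word that represents its Demazure product with the least number of letters. -/
def IsReducedWord (ks : List ℕ) (v : Equiv.Perm (Fin N)) : Prop :=
  demWord N ks = v ∧ ks.length = permLength v

/-- Out-of-range letters can be deleted without changing the product, which would leave fewer than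
`permLength v` letters. -/
theorem IsReducedWord.lt {ks : List ℕ} {v : Equiv.Perm (Fin N)} (h : IsReducedWord ks v) :
    ∀ k ∈ ks, k + 1 < N := by
  have h1 := permLength_demWord_le (N := N) (ks.filter fun k => k + 1 < N)
  rw [demWord_filter_lt, h.1, ← h.2] at h1
  have h2 : (ks.filter fun k => k + 1 < N) = ks :=
    (List.filter_sublist (p := fun k => decide (k + 1 < N)) (l := ks)).eq_of_length_le h1
  simpa using List.filter_eq_self.1 h2

/-- In a reduced word the last step must raise the length. This recursion is the one that the
operators `nilOp` encode. -/
theorem isReducedWord_append_singleton (ks : List ℕ) (k : ℕ) (v : Equiv.Perm (Fin N)) :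
    IsReducedWord (ks ++ [k]) v ↔ IsDescent v k ∧ IsReducedWord ks (v * adjSwap N k) := by
  constructor
  · rintro ⟨h1, h2⟩
    rw [demWord_append_singleton] at h1
    rw [List.length_append, List.length_singleton] at h2
    have h3 := permLength_demWord_le (N := N) ks
    have hne : demStep (demWord N ks) k ≠ demWord N ks := by
      intro he
      rw [← he, h1] at h3
      omega
    by_cases hk : k + 1 < N
    · rcases isAscent_or_isDescent (demWord N ks) hk with h | h
      · rw [h.demStep_eq] at h1
        subst h1
        refine ⟨h.mul_adjSwap, by simp, ?_⟩
        rw [h.permLength_mul] at h2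
        rw [mul_adjSwap_mul_adjSwap]
        omega
      · exact absurd h.demStep_eq hne
    · exact absurd (demStep_of_le _ (not_lt.1 hk)) hne
  · rintro ⟨h, h1, h2⟩
    refine ⟨?_, ?_⟩
    · rw [demWord_append_singleton, h1, h.mul_adjSwap.demStep_eq, mul_adjSwap_mul_adjSwap]
    · rw [List.length_append, List.length_singleton, h2, h.permLength_mul]

end DemWord

/-! ### Stabilization -/

/-- The inclusion of `S_n` into `S_{2n}`. -/
def embedPerm {n : ℕ} (w : Equiv.Perm (Fin n)) : Equiv.Perm (Fin (n + n)) :=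
  finSumFinEquiv.permCongr (Equiv.Perm.sumCongr w 1)

section Stabilize

variable {n : ℕ}

@[simp] theorem embedPerm_castAdd (w : Equiv.Perm (Fin n)) (i : Fin n) :
    embedPerm w (Fin.castAdd n i) = Fin.castAdd n (w i) := by
  simp [embedPerm, Equiv.permCongr_apply]

@[simp] theorem embedPerm_natAdd (w : Equiv.Perm (Fin n)) (i : Fin n) :
    embedPerm w (Fin.natAdd n i) = Fin.natAdd n i := by
  simp [embedPerm, Equiv.permCongr_apply, -Fin.natAdd_eq_addNat]

theorem embedPerm_mul (v w : Equiv.Perm (Fin n)) :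
    embedPerm (v * w) = embedPerm v * embedPerm w := by
  ext i
  refine Fin.addCases (fun i => ?_) (fun i => ?_) i <;> simp [-Fin.natAdd_eq_addNat]

theorem embedPerm_one : embedPerm (1 : Equiv.Perm (Fin n)) = 1 := by
  ext i
  refine Fin.addCases (fun i => ?_) (fun i => ?_) i <;> simp [-Fin.natAdd_eq_addNat]

theorem embedPerm_mk (w : Equiv.Perm (Fin n)) {i : ℕ} (hi : i < n) (hi' : i < n + n) :
    (embedPerm w ⟨i, hi'⟩ : ℕ) = w ⟨i, hi⟩ := by
  have := embedPerm_castAdd w ⟨i, hi⟩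
  rw [show (⟨i, hi'⟩ : Fin (n + n)) = Fin.castAdd n ⟨i, hi⟩ from rfl, this]
  rfl

theorem embedPerm_adjSwap {k : ℕ} (hk : k + 1 < n) :
    embedPerm (adjSwap n k) = adjSwap (n + n) k := by
  ext i
  refine Fin.addCases (fun i => ?_) (fun i => ?_) i
  · rcases i with ⟨i, hi⟩
    rw [embedPerm_castAdd]
    simp only [Fin.castAdd_mk, Fin.val_castAdd]
    by_cases h1 : i = k
    · subst h1
      rw [adjSwap_apply_left hk, adjSwap_apply_left (show i + 1 < n + n by omega)]
    by_cases h2 : i = k + 1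
    · subst h2
      rw [adjSwap_apply_right hk, adjSwap_apply_right (show k + 1 < n + n by omega)]
    rw [adjSwap_apply_of_ne hi h1 h2, adjSwap_apply_of_ne _ h1 h2]
  · rw [embedPerm_natAdd]
    rcases i with ⟨i, hi⟩
    simp only [Fin.natAdd_mk]
    rw [adjSwap_apply_of_ne _ (by omega) (by omega)]

theorem demStep_embedPerm (w : Equiv.Perm (Fin n)) {k : ℕ} (hk : k + 1 < n) :
    demStep (embedPerm w) k = embedPerm (demStep w k) := by
  have hk' : k + 1 < n + n := by omega
  rcases isAscent_or_isDescent w hk with h | h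
  · have h' : IsAscent (embedPerm w) k := by
      refine ⟨hk', ?_⟩
      rw [Fin.lt_def, embedPerm_mk w hk, embedPerm_mk w (show k < n by omega)]
      exact h.2
    rw [h.demStep_eq, h'.demStep_eq, embedPerm_mul, embedPerm_adjSwap hk]
  · have h' : IsDescent (embedPerm w) k := by
      refine ⟨hk', ?_⟩
      rw [Fin.lt_def, embedPerm_mk w hk, embedPerm_mk w (show k < n by omega)]
      exact h.2
    rw [h.demStep_eq, h'.demStep_eq]

theorem demWord_filter_embedPerm (ks : List ℕ) :
    demWord (n + n) (ks.filter fun k => k + 1 < n) = embedPerm (demWord n ks) := by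
  induction ks using List.reverseRecOn with
  | nil => exact embedPerm_one.symm
  | append_singleton ks k ih =>
    rw [List.filter_append, demWord_append_singleton]
    by_cases hk : k + 1 < n
    · simp [hk, demWord_append_singleton, ih, demStep_embedPerm]
    · simp [hk, ih, demStep_of_le _ (not_lt.1 hk)]

theorem stabilize_permMat (w : Equiv.Perm (Fin n)) :
    stabilize (permMat w) = permMat (embedPerm w) := by
  ext i j
  refine Fin.addCases (fun i => ?_) (fun i => ?_) i <;>
    refine Fin.addCases (fun j => ?_) (fun j => ?_) j
  · simp [stabilize, permMat]
  · have : Fin.castAdd n (w i) ≠ Fin.natAdd n j := by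
      rw [Ne, Fin.ext_iff, Fin.val_castAdd, Fin.val_natAdd]
      omega
    simp [stabilize, permMat, this, -Fin.natAdd_eq_addNat]
  · have : Fin.natAdd n i ≠ Fin.castAdd n j := by
      rw [Ne, Fin.ext_iff, Fin.val_castAdd, Fin.val_natAdd]
      omega
    simp [stabilize, permMat, this, -Fin.natAdd_eq_addNat]
  · simp [stabilize, permMat, Matrix.one_apply, -Fin.natAdd_eq_addNat]

theorem rankFn_stabilize (A : Matrix (Fin n) (Fin n) ℤ) (i j : ℕ) :
    rankFn (stabilize A) i j =
      rankFn A i j + rankFn (permMat (1 : Equiv.Perm (Fin n))) (i - n) (j - n) := by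
  unfold rankFn
  rw [Fin.sum_univ_add]
  congr 1
  · refine Finset.sum_congr rfl fun a _ => ?_
    rw [Fin.sum_univ_add]
    simp [stabilize, -Fin.natAdd_eq_addNat]
  · refine Finset.sum_congr rfl fun a _ => ?_
    rw [Fin.sum_univ_add]
    have h : ∀ (a : Fin n) (i : ℕ), n + (a : ℕ) < i ↔ (a : ℕ) < i - n := by intros; omega
    simp [stabilize, permMat, Matrix.one_apply, h, -Fin.natAdd_eq_addNat]
    refine Finset.sum_congr rfl fun b _ => ?_
    by_cases hab : a = b <;> simp [hab]

theorem asmLE_stabilize_iff (A B : Matrix (Fin n) (Fin n) ℤ) :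
    AsmLE (stabilize A) (stabilize B) ↔ AsmLE A B := by
  rw [asmLE_iff_dominates, asmLE_iff_dominates]
  constructor
  · intro h i hi j hj
    have := h i (by omega) j (by omega)
    rw [rankFn_stabilize, rankFn_stabilize] at this
    omega
  · intro h i hi j hj
    rw [rankFn_stabilize, rankFn_stabilize]
    have := h (min i n) (min_le_right _ _) (min j n) (min_le_right _ _)
    rw [rankFn_min, rankFn_min] at this
    omega

/-- The property of rank functions of stabilized matrices that makes letters `s_k` with
`n ≤ k + 1` superfluous. -/
structure IsStableRank (n : ℕ) (r : ℕ → ℕ → ℤ) : Prop where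
  steps : UnitSteps (n + n) r
  eq_min : ∀ i ≤ n + n, ∀ j ≤ n + n, n ≤ i ∨ n ≤ j → r i j = min i j

/-- Outside the `n × n` square `r` agrees with the rank function `min i j` of the identity, which is
already the largest possible. In the corner case `k + 1 = n`, `j < n`, both rows `k + 1` and `k + 2`
have the value `j`. -/
theorem IsStableRank.rowSup_eq {r : ℕ → ℕ → ℤ} (h : IsStableRank n r) {k : ℕ} (hk : n ≤ k + 1)
    (hk' : k + 1 < n + n) : Dominates (n + n) r (rowSup k r) := by
  intro i hi j hj
  unfold rowSup
  split_ifs with hik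
  · subst hik
    rw [h.eq_min (k + 1) hi j hj (by omega), h.eq_min (k + 2) (by omega) j hj (by omega)]
    by_cases hj' : n ≤ j ∨ n ≤ k
    · rw [h.eq_min k (by omega) j hj (by omega)]
      omega
    · omega
  · exact le_rfl

theorem IsStableRank.rowSup {r : ℕ → ℕ → ℤ} (h : IsStableRank n r) {k : ℕ} (hk : k + 1 < n) :
    IsStableRank n (rowSup k r) := by
  constructor
  · intro i hi j hj
    have h0 := h.steps i hi j hj
    have h1 := h.steps k (by omega) j hj
    have h2 := h.steps (k + 1) (by omega) j hj
    rw [show k + 1 + 1 = k + 2 from rfl] at h2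
    unfold AsmSchubert.rowSup
    by_cases hik : i = k + 1
    · subst hik
      rw [if_pos rfl, if_neg (by omega)]
      rw [show k + 1 + 1 = k + 2 from rfl] at *
      omega
    · by_cases hik' : i = k
      · subst hik'
        rw [if_neg (by omega), if_pos rfl]
        omega
      · rwa [if_neg hik, if_neg (by omega)]
  · intro i hi j hj hij
    unfold AsmSchubert.rowSup
    split_ifs with hik
    · subst hik
      rw [h.eq_min k (by omega) j hj (by omega), h.eq_min (k + 2) (by omega) j hj (by omega)]
      omega
    · exact h.eq_min i hi j hj hij

/-- Each last letter is moved to `r` by adjunction. A letter outside `S_n` leaves `r` above its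
`rowSup` and is dropped; a letter of `S_n` is moved back afterwards. The class of stable `r` is used
because it is closed under these `rowSup`. -/
theorem IsStableRank.dominates_filter {r : ℕ → ℕ → ℤ} (h : IsStableRank n r) (ks : List ℕ)
    (hr : Dominates (n + n) r (rankFn (permMat (demWord (n + n) ks)))) :
    Dominates (n + n) r
      (rankFn (permMat (demWord (n + n) (ks.filter fun k => k + 1 < n)))) := by
  induction ks using List.reverseRecOn generalizing r with
  | nil => exact hr
  | append_singleton ks k ih =>
    rw [List.filter_append]
    rw [demWord_append_singleton] at hr
    by_cases hk' : k + 1 < n + n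
    · rw [rankFn_demStep _ hk'] at hr
      have hr' := Dominates.rowSup_of_rowInf (unitSteps_permMat _) hk' hr
      by_cases hk : k + 1 < n
      · simp only [hk, decide_true, List.filter_cons_of_pos, List.filter_nil]
        rw [demWord_append_singleton, rankFn_demStep _ hk']
        exact Dominates.rowInf_of_rowSup h.steps hk' (ih (h.rowSup hk) hr')
      · simp only [hk, decide_false, List.filter_cons_of_neg, List.filter_nil, List.append_nil,
          Bool.false_eq_true, not_false_eq_true]
        exact ih h ((h.rowSup_eq (not_lt.1 hk) hk').trans hr')
    · rw [demStep_of_le _ (not_lt.1 hk')] at hr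
      have hk : ¬ k + 1 < n := by omega
      simp only [hk, decide_false, List.filter_cons_of_neg, List.filter_nil, List.append_nil,
          Bool.false_eq_true, not_false_eq_true]
      exact ih h hr

end Stabilize

/-! ### Alternating sign matrices -/

section AlternatingSign

variable {n : ℕ}

/-- Partial sums of an alternating sequence over an interval that starts at `a`. -/
theorem alternating_partialSum {v : ℕ → ℤ}
    (halt : ∀ j j', j < j' → v j ≠ 0 → v j' ≠ 0 → (∀ k, j < k → k < j' → v k = 0) → v j' = -v j)
    (a d : ℕ) :
    ∑ k ∈ Finset.range d, v (a + k) = 0 ∨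
      ∃ p < a + d, v p ≠ 0 ∧ (∀ k, p < k → k < a + d → v k = 0) ∧
        ∑ k ∈ Finset.range d, v (a + k) = v p := by
  induction d with
  | zero => simp
  | succ d ih =>
    rw [Finset.sum_range_succ]
    by_cases hv : v (a + d) = 0
    · rw [hv, add_zero]
      refine ih.imp_right ?_
      rintro ⟨p, hp, h1, h2, h3⟩
      refine ⟨p, by omega, h1, fun k hk hk' => ?_, h3⟩
      rcases Nat.lt_succ_iff_lt_or_eq.1 (show k < a + d + 1 by omega) with h | h
      · exact h2 k hk h
      · rw [h, hv]
    · rcases ih with ih | ⟨p, hp, h1, h2, h3⟩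
      · exact Or.inr ⟨a + d, by omega, hv, fun k hk hk' => by omega, by rw [ih, zero_add]⟩
      · left
        rw [h3, halt p (a + d) hp h1 hv h2, add_neg_cancel]

/-- All interval sums lie in `[-1, 1]`. A prefix sum is thus at most `1`, and it is at least `0`
because the complementary suffix sum is at most `1` and the total is `1`. -/
theorem IsAlternatingLine.partialSum_mem {v : Fin n → ℤ} (hv : IsAlternatingLine v) (j : ℕ) :
    0 ≤ (∑ b : Fin n, if (b : ℕ) < j then v b else 0) ∧
      (∑ b : Fin n, if (b : ℕ) < j then v b else 0) ≤ 1 := by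
  classical
  obtain ⟨h1, h2, h3⟩ := hv
  set u : ℕ → ℤ := fun k => if h : k < n then v ⟨k, h⟩ else 0 with hu
  have hu1 : ∀ k, -1 ≤ u k ∧ u k ≤ 1 := by
    intro k
    simp only [hu]
    split_ifs with h
    · rcases h1 ⟨k, h⟩ with h | h | h <;> rw [h] <;> norm_num
    · norm_num
  have hu2 : ∀ j j', j < j' → u j ≠ 0 → u j' ≠ 0 → (∀ k, j < k → k < j' → u k = 0) →
      u j' = -u j := by
    intro j j' hjj hj hj' hk
    have hn : j' < n := by
      by_contra hc
      simp [hu, hc] at hj'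
    have hn' : j < n := hjj.trans hn
    simp only [hu, hn, hn', dif_pos] at hj hj' ⊢
    refine h2 ⟨j, hn'⟩ ⟨j', hn⟩ hjj hj hj' fun k hk1 hk2 => ?_
    have := hk k hk1 hk2
    simpa [hu] using this
  have hb : ∀ a d, -1 ≤ ∑ k ∈ Finset.range d, u (a + k) ∧ ∑ k ∈ Finset.range d, u (a + k) ≤ 1 := by
    intro a d
    rcases alternating_partialSum hu2 a d with h | ⟨p, -, -, -, h⟩
    · rw [h]; norm_num
    · rw [h]; exact hu1 p
  have hsum : ∀ j, (∑ b : Fin n, if (b : ℕ) < j then v b else 0) =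
      ∑ k ∈ Finset.range (min j n), u k := by
    intro j
    have e1 : (∑ b : Fin n, if (b : ℕ) < j then v b else 0) =
        ∑ b : Fin n, (fun k => if k < j then u k else 0) (b : ℕ) := by
      refine Finset.sum_congr rfl fun b _ => ?_
      simp [hu]
    rw [e1, Fin.sum_univ_eq_sum_range (fun k => if k < j then u k else 0) n, ← Finset.sum_filter]
    refine Finset.sum_congr ?_ fun _ _ => rfl
    ext k
    rw [Finset.mem_filter, Finset.mem_range, Finset.mem_range]
    omega
  have htot : ∑ k ∈ Finset.range n, u k = 1 := by
    have := hsum n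
    simp only [Fin.is_lt, if_true, min_self] at this
    rw [← this, h3]
  have hle : min j n ≤ n := min_le_right _ _
  obtain ⟨d, hd⟩ := Nat.exists_eq_add_of_le hle
  have hsplit := Finset.sum_range_add u (min j n) d
  rw [← hd, htot] at hsplit
  rw [hsum]
  have e1 := hb 0 (min j n)
  have e2 := hb (min j n) d
  simp only [zero_add] at e1
  omega

theorem IsASM.rankFn_left {A : Matrix (Fin n) (Fin n) ℤ} (hA : IsASM A) {i j : ℕ} (hi : n ≤ i) :
    rankFn A i j = min j n := by
  have h1 : rankFn A i j = ∑ b : Fin n, if (b : ℕ) < j then (1 : ℤ) else 0 := by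
    unfold rankFn
    rw [Finset.sum_comm]
    refine Finset.sum_congr rfl fun b _ => ?_
    have hlt : ∀ a : Fin n, (a : ℕ) < i := fun a => a.isLt.trans_le hi
    simp only [hlt, true_and]
    split_ifs
    · exact (hA.2 b).2.2
    · simp
  have h2 : rankFn (permMat (1 : Equiv.Perm (Fin n))) n j =
      ∑ b : Fin n, if (b : ℕ) < j then (1 : ℤ) else 0 := by
    simp [rankFn_permMat]
  rw [h1, ← h2, rankFn_permMat_one le_rfl, min_comm]

theorem IsASM.rankFn_right {A : Matrix (Fin n) (Fin n) ℤ} (hA : IsASM A) {i j : ℕ} (hj : n ≤ j)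
    (hi : i ≤ n) : rankFn A i j = i := by
  induction i with
  | zero => simp
  | succ i ih =>
    rw [rankFn_succ _ hi, ih (by omega)]
    have hlt : ∀ a : Fin n, (a : ℕ) < j := fun a => a.isLt.trans_le hj
    simp only [hlt, if_true]
    rw [(hA.1 ⟨i, hi⟩).2.2]
    simp

theorem IsASM.isStableRank {A : Matrix (Fin n) (Fin n) ℤ} (hA : IsASM A) :
    IsStableRank n (rankFn (stabilize A)) := by
  constructor
  · intro i hi j hj
    rw [rankFn_stabilize, rankFn_stabilize]
    by_cases hin : i < n
    · rw [show i + 1 - n = 0 by omega, show i - n = 0 by omega, rankFn_succ _ hin]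
      have := (hA.1 ⟨i, hin⟩).partialSum_mem j
      omega
    · rw [hA.rankFn_left (show n ≤ i by omega), hA.rankFn_left (show n ≤ i + 1 by omega),
        show i + 1 - n = i - n + 1 by omega]
      have := rankFn_permMat_step (1 : Equiv.Perm (Fin n)) (i - n) (j - n) (by omega)
      omega
  · intro i hi j hj hij
    rw [rankFn_stabilize, rankFn_permMat_one (by omega)]
    by_cases hin : n ≤ i
    · rw [hA.rankFn_left hin]
      omega
    · rw [hA.rankFn_right (show n ≤ j by omega) (by omega)]
      omega

/-- A word in `S_{2n}` lies above a stabilized alternating sign matrix if and only if its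
subword in `S_n` does so. -/
theorem IsASM.asmLE_demWord_iff {A : Matrix (Fin n) (Fin n) ℤ} (hA : IsASM A) (ks : List ℕ) :
    AsmLE (stabilize A) (permMat (demWord (n + n) ks)) ↔ AsmLE A (permMat (demWord n ks)) := by
  rw [← asmLE_stabilize_iff A, stabilize_permMat, ← demWord_filter_embedPerm, asmLE_iff_dominates,
    asmLE_iff_dominates]
  exact ⟨hA.isStableRank.dominates_filter ks,
    fun h => h.trans (dominates_demWord_of_sublist List.filter_sublist)⟩

end AlternatingSign

/-! ### Subwords of the square word -/

section SquareWord

variable {n : ℕ}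

/-- The indices of the letters of the square word that are in the boxes of `P`. -/
def boxWord (P : Finset (Fin n × Fin n)) : List ℕ :=
  ((readingOrder n).filter fun c => c ∈ P).map fun c => (c.1 : ℕ) + (c.2 : ℕ)

theorem demazure_subword (P : Finset (Fin n × Fin n)) :
    demazure (subword P) = demWord (n + n) (boxWord P) := by
  unfold demazure subword demWord boxWord
  rw [List.foldl_map, List.foldl_map]
  congr 1
  funext w c
  rw [cellLetter, ← adjSwap_eq]
  rfl

theorem nodup_readingOrder : (readingOrder n).Nodup := by
  rw [readingOrder, List.nodup_flatMap]
  constructor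
  · intro i _
    refine List.Nodup.map ?_ (List.nodup_reverse.2 (List.nodup_finRange n))
    intro a b hab
    exact (Prod.mk.inj hab).2
  · refine (List.nodup_finRange n).imp ?_
    intro a b hab x hx hx'
    simp only [List.mem_map] at hx hx'
    obtain ⟨_, _, rfl⟩ := hx
    obtain ⟨_, _, h⟩ := hx'
    exact hab (Prod.mk.inj h).1.symm

theorem mem_readingOrder (c : Fin n × Fin n) : c ∈ readingOrder n := by
  simp [readingOrder]

theorem length_boxWord (P : Finset (Fin n × Fin n)) : (boxWord P).length = P.card := by
  rw [boxWord, List.length_map, ← List.toFinset_card_of_nodup (nodup_readingOrder.filter _)]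
  congr 1
  ext c
  simp [mem_readingOrder]

theorem boxWord_sublist {P Q : Finset (Fin n × Fin n)} (h : P ⊆ Q) :
    List.Sublist (boxWord P) (boxWord Q) := by
  refine List.Sublist.map _ ?_
  refine List.monotone_filter_right _ fun c hc => ?_
  simpa using h (by simpa using hc)

/-- Translates sublists into sets of boxes: without repetitions, a sublist is recovered from its
underlying set. -/
theorem filter_mem_toFinset_eq {α : Type*} [DecidableEq α] {L L' : List α} (hL : L.Nodup)
    (h : List.Sublist L' L) : (L.filter fun c => c ∈ L'.toFinset) = L' := by
  have h1 : List.Sublist L' (L.filter fun c => c ∈ L'.toFinset) := by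
    have := h.filter fun c => decide (c ∈ L'.toFinset)
    rwa [List.filter_eq_self.2 (by simp)] at this
  refine (h1.eq_of_length_le ?_).symm
  rw [← List.toFinset_card_of_nodup (hL.filter _), ← List.toFinset_card_of_nodup (h.nodup hL)]
  exact Finset.card_le_card fun c => by simp

/-- The subword property for the square word. -/
theorem exists_isReducedWord_of_asmLE {P : Finset (Fin n × Fin n)} {v : Equiv.Perm (Fin n)}
    (h : AsmLE (permMat v) (permMat (demWord n (boxWord P)))) :
    ∃ Q ⊆ P, IsReducedWord (boxWord Q) v := by
  rw [asmLE_iff_dominates] at h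
  obtain ⟨L, h1, h2, h3⟩ := exists_sublist_demWord_eq _ _ v h
  have h4 : ((readingOrder n).filter fun c => c ∈ L.toFinset) = L :=
    filter_mem_toFinset_eq nodup_readingOrder (h1.trans List.filter_sublist)
  refine ⟨L.toFinset, fun c hc => ?_, ?_, ?_⟩
  · have := h1.subset (List.mem_toFinset.1 hc)
    simpa using (List.mem_filter.1 this).2
  · rw [boxWord, h4, h2]
  · rw [boxWord, h4, List.length_map, h3]

/-! ### Facets and faces of maximal dimension -/

theorem AsmLE.refl_mat (A : Matrix (Fin n) (Fin n) ℤ) : AsmLE A A := fun _ _ => le_rfl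

theorem mem_permsAbove {A : Matrix (Fin n) (Fin n) ℤ} {v : Equiv.Perm (Fin n)} :
    v ∈ permsAbove A ↔ AsmLE A (permMat v) := by
  simp [permsAbove]

theorem mem_permSet {A : Matrix (Fin n) (Fin n) ℤ} {w : Equiv.Perm (Fin n)} :
    w ∈ permSet A ↔ AsmLE A (permMat w) ∧
      ∀ v, AsmLE A (permMat v) → AsmLE (permMat v) (permMat w) → v = w := by
  simp [permSet, mem_permsAbove]

theorem IsASM.mem_asmComplex {A : Matrix (Fin n) (Fin n) ℤ} (hA : IsASM A)
    {F : Finset (Fin n × Fin n)} :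
    F ∈ asmComplex A ↔ AsmLE A (permMat (demWord n (boxWord Fᶜ))) := by
  rw [← hA.asmLE_demWord_iff, ← demazure_subword]
  simp [asmComplex]

theorem mem_facets {α : Type*} {Δ : Finset (Finset α)} {F : Finset α} :
    F ∈ facets Δ ↔ F ∈ Δ ∧ ∀ G ∈ Δ, F ⊆ G → F = G := by
  simp [facets]

/-- For a facet, any `v ≥ A` below the product of `Fᶜ` is spelled reducedly inside `Fᶜ`, and
maximality makes that subword all of `Fᶜ`. Conversely, a smaller box set with product above `A`
still has product `v` by minimality, hence needs all `permLength v` letters. -/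
theorem IsASM.mem_facets_iff {A : Matrix (Fin n) (Fin n) ℤ} (hA : IsASM A)
    {F : Finset (Fin n × Fin n)} :
    F ∈ facets (asmComplex A) ↔ ∃ v ∈ permSet A, IsReducedWord (boxWord Fᶜ) v := by
  rw [mem_facets, hA.mem_asmComplex]
  constructor
  · rintro ⟨hF, hmax⟩
    have key : ∀ v, AsmLE A (permMat v) →
        AsmLE (permMat v) (permMat (demWord n (boxWord Fᶜ))) → IsReducedWord (boxWord Fᶜ) v := by
      intro v hv hle
      obtain ⟨Q, hQ, hred⟩ := exists_isReducedWord_of_asmLE hle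
      have := hmax Qᶜ (by rwa [hA.mem_asmComplex, compl_compl, hred.1])
        (Finset.subset_compl_comm.1 hQ)
      rwa [this, compl_compl]
    exact ⟨_, mem_permSet.2 ⟨hF, fun v hv hle => (key v hv hle).1.symm⟩,
      key _ hF (AsmLE.refl_mat _)⟩
  · rintro ⟨v, hv, hred⟩
    rw [mem_permSet] at hv
    refine ⟨by rw [hred.1]; exact hv.1, fun G hG hFG => ?_⟩
    rw [hA.mem_asmComplex] at hG
    have hsub : Gᶜ ⊆ Fᶜ := Finset.compl_subset_compl.2 hFG
    have h1 : demWord n (boxWord Gᶜ) = v := by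
      refine hv.2 _ hG ?_
      rw [← hred.1, asmLE_iff_dominates]
      exact dominates_demWord_of_sublist (boxWord_sublist hsub)
    have h2 := permLength_demWord_le (N := n) (boxWord Gᶜ)
    rw [h1, ← hred.2, length_boxWord, length_boxWord] at h2
    exact compl_injective (Finset.eq_of_subset_of_card_le hsub h2).symm

theorem IsASM.asmDeg_le {A : Matrix (Fin n) (Fin n) ℤ} (hA : IsASM A)
    {F : Finset (Fin n × Fin n)} (hF : F ∈ asmComplex A) : asmDeg A ≤ Fᶜ.card := by
  rw [hA.mem_asmComplex] at hF
  rw [← length_boxWord]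
  have h : asmDeg A ≤ permLength (demWord n (boxWord Fᶜ)) :=
    Nat.sInf_le ⟨_, mem_permsAbove.2 hF, rfl⟩
  exact h.trans (permLength_demWord_le _)

/-- Maximal dimension means that `Fᶜ` has the fewest boxes. This number is `asmDeg A`, provided a
permutation of that length is spelled by some box set; `hex` supplies it. -/
theorem IsASM.mem_maxFacets_iff {A : Matrix (Fin n) (Fin n) ℤ} (hA : IsASM A)
    (hex : ∀ v : Equiv.Perm (Fin n), ∃ P : Finset (Fin n × Fin n), IsReducedWord (boxWord P) v)
    {F : Finset (Fin n × Fin n)} :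
    F ∈ maxFacets (asmComplex A) ↔ ∃ v ∈ minPermSet A, IsReducedWord (boxWord Fᶜ) v := by
  have hcompl : ∀ G : Finset (Fin n × Fin n), G.card + Gᶜ.card = Fintype.card (Fin n × Fin n) :=
    fun G => Finset.card_add_card_compl G
  have hsup : F ∈ maxFacets (asmComplex A) ↔
      F ∈ asmComplex A ∧ ∀ G ∈ asmComplex A, Fᶜ.card ≤ Gᶜ.card := by
    unfold maxFacets complexDim faceDim
    rw [Finset.mem_filter]
    refine and_congr_right fun hF => ?_
    have h1 : F.card ≤ (asmComplex A).sup Finset.card := Finset.le_sup (f := Finset.card) hF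
    have h2 : (((asmComplex A).sup Finset.card : ℕ) : ℤ) - 1 - ((F.card : ℤ) - 1) = 0 ↔
        (asmComplex A).sup Finset.card ≤ F.card := by omega
    rw [h2, Finset.sup_le_iff]
    refine forall₂_congr fun G _ => ?_
    have := hcompl F
    have := hcompl G
    omega
  rw [hsup]
  constructor
  · rintro ⟨hF, hmin⟩
    have hfacet : F ∈ facets (asmComplex A) := by
      refine mem_facets.2 ⟨hF, fun G hG hFG => Finset.eq_of_subset_of_card_le hFG ?_⟩
      have := hmin G hG
      have := hcompl F
      have := hcompl G
      omega
    obtain ⟨v, hv, hred⟩ := hA.mem_facets_iff.1 hfacet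
    refine ⟨v, Finset.mem_filter.2 ⟨hv, ?_⟩, hred⟩
    obtain ⟨u, hu, hul⟩ := Nat.sInf_mem (s := {l : ℕ | ∃ w ∈ permsAbove A, permLength w = l})
      ⟨_, v, mem_permsAbove.2 (mem_permSet.1 hv).1, rfl⟩
    refine le_antisymm ?_ ?_
    · obtain ⟨P, hP⟩ := hex u
      have hPA : Pᶜ ∈ asmComplex A := by
        rw [hA.mem_asmComplex, compl_compl, hP.1]
        exact mem_permsAbove.1 hu
      have := hmin _ hPA
      rw [compl_compl, ← length_boxWord, ← length_boxWord, hred.2, hP.2, hul] at this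
      exact this
    · rw [← hred.2, length_boxWord]
      exact hA.asmDeg_le hF
  · rintro ⟨v, hv, hred⟩
    obtain ⟨hv, hdeg⟩ := Finset.mem_filter.1 hv
    refine ⟨(mem_facets.1 (hA.mem_facets_iff.2 ⟨v, hv, hred⟩)).1, fun G hG => ?_⟩
    rw [← length_boxWord Fᶜ, hred.2, hdeg]
    exact hA.asmDeg_le hG

end SquareWord

/-! ### Products of factors `1 + x u_k` in the nilCoxeter algebra -/

section NilCoxeter

variable {R E : Type*} [CommRing R] [Ring E] [Algebra R E]

/-- The nilCoxeter relations. -/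
structure NilCoxeterRel (u : ℕ → E) : Prop where
  sq : ∀ k, u k * u k = 0
  comm : ∀ k l, k + 2 ≤ l → u k * u l = u l * u k
  braid : ∀ k, u k * u (k + 1) * u k = u (k + 1) * u k * u (k + 1)

/-- The product `(1 + x u_m) (1 + x u_{m+1}) ⋯` of `d` factors. -/
def rowProd (u : ℕ → E) (x : R) : ℕ → ℕ → E
  | _, 0 => 1
  | m, d + 1 => (1 + x • u m) * rowProd u x (m + 1) d

theorem rowProd_succ_right (u : ℕ → E) (x : R) (m d : ℕ) :
    rowProd u x m (d + 1) = rowProd u x m d * (1 + x • u (m + d)) := by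
  induction d generalizing m with
  | zero => simp [rowProd]
  | succ d ih =>
    rw [rowProd, ih (m + 1), rowProd, mul_assoc, show m + 1 + d = m + (d + 1) by omega]

theorem NilCoxeterRel.commute_rowProd {u : ℕ → E} (h : NilCoxeterRel u) (x : R) {k m : ℕ}
    (hkm : k + 2 ≤ m) (d : ℕ) : Commute (u k) (rowProd u x m d) := by
  induction d generalizing m with
  | zero => exact Commute.one_right _
  | succ d ih =>
    refine Commute.mul_right (Commute.add_right (Commute.one_right _) ?_) (ih (by omega))
    exact Commute.smul_right (h.comm k m hkm) x

theorem one_add_smul_mul_one_sub {a : E} (ha : a * a = 0) (x : R) :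
    (1 + x • a) * (1 - x • a) = 1 ∧ (1 - x • a) * (1 + x • a) = 1 := by
  constructor <;> simp [mul_add, add_mul, mul_sub, sub_mul, ha]

/-- A form of the Yang–Baxter relation. -/
theorem yangBaxter {a b : E} (ha : a * a = 0) (hb : b * b = 0) (hab : a * b * a = b * a * b)
    (x y : R) :
    (1 + y • a) * (1 + y • b) * (1 + x • a) * (1 - y • b) =
      (1 + x • a) * (1 + x • b) * (1 + y • a) * (1 - x • b) := by
  have h : ∀ c, c * b * b = 0 := fun c => by rw [mul_assoc, hb, mul_zero]
  simp only [mul_add, add_mul, mul_sub, mul_one, one_mul, smul_mul_assoc, mul_smul_comm,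
    ha, hb, h, hab, smul_zero, zero_mul]
  module

/-- Since `u m` commutes with the factors of index at least `m + 2`, a product of two rows becomes a
word in `u m` and `u (m + 1)` times the product of the rows from `m + 1` on. The first part is
symmetric by `yangBaxter`, the second by induction. -/
theorem NilCoxeterRel.rowProd_comm {u : ℕ → E} (h : NilCoxeterRel u) (x y : R) (m d : ℕ) :
    rowProd u x m d * rowProd u y m d = rowProd u y m d * rowProd u x m d := by
  induction d generalizing m with
  | zero => rfl
  | succ d ih =>
    rcases d with _ | d
    · simp only [rowProd, mul_one, mul_add, add_mul, one_mul, smul_mul_assoc, mul_smul_comm, h.sq,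
        smul_zero]
      module
    · have key : ∀ x y : R, rowProd u y m (d + 2) * rowProd u x m (d + 2) =
          (1 + y • u m) * (1 + y • u (m + 1)) * (1 + x • u m) * (1 - y • u (m + 1)) *
            (rowProd u y (m + 1) (d + 1) * rowProd u x (m + 1) (d + 1)) := by
        intro x y
        -- Reinserting the factor `1 + y u_{m+1}` and its inverse `1 - y u_{m+1}` restores a full
        -- row from `m + 1`, as the induction hypothesis requires.
        have h1 : rowProd u y (m + 2) d =
            (1 - y • u (m + 1)) * rowProd u y (m + 1) (d + 1) := by
          rw [rowProd, ← mul_assoc, (one_add_smul_mul_one_sub (h.sq _) y).2, one_mul]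
        have h2 : Commute (1 + x • u m) (rowProd u y (m + 2) d) :=
          Commute.add_left (Commute.one_left _)
            (Commute.smul_left (h.commute_rowProd y le_rfl d) x)
        calc rowProd u y m (d + 2) * rowProd u x m (d + 2)
            = (1 + y • u m) * (1 + y • u (m + 1)) * (rowProd u y (m + 2) d * (1 + x • u m)) *
                rowProd u x (m + 1) (d + 1) := by
              rw [rowProd, rowProd, rowProd.eq_2 u x m]
              simp only [mul_assoc]
          _ = _ := by
              rw [← h2.eq, h1]
              simp only [mul_assoc]
      rw [key x y, key y x, ih, yangBaxter (h.sq m) (h.sq (m + 1)) (h.braid m)]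

end NilCoxeter

/-! ### The nilCoxeter operators on functions on `S_n` -/

section NilOp

variable {n : ℕ} {R : Type*} [CommRing R]

open scoped Classical in
/-- Right multiplication by `u_k` in the nilCoxeter algebra, whose elements are written as
functions on `S_n`. -/
noncomputable def nilOp (n : ℕ) (R : Type*) [CommRing R] (k : ℕ) :
    Module.End R (Equiv.Perm (Fin n) → R) where
  toFun f w := if IsDescent w k then f (w * adjSwap n k) else 0
  map_add' f g := by
    funext w
    by_cases h : IsDescent w k <;> simp [h]
  map_smul' a f := by
    funext w
    by_cases h : IsDescent w k <;> simp [h]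

theorem nilOp_apply_of_isDescent {w : Equiv.Perm (Fin n)} {k : ℕ} (h : IsDescent w k)
    (f : Equiv.Perm (Fin n) → R) : nilOp n R k f w = f (w * adjSwap n k) := if_pos h

theorem nilOp_apply_of_not_isDescent {w : Equiv.Perm (Fin n)} {k : ℕ} (h : ¬ IsDescent w k)
    (f : Equiv.Perm (Fin n) → R) : nilOp n R k f w = 0 := if_neg h

theorem nilOp_eq_zero {k : ℕ} (h : n ≤ k + 1) : nilOp n R k = 0 := by
  refine LinearMap.ext fun f => funext fun w => ?_
  rw [nilOp_apply_of_not_isDescent fun hw => by have := hw.1; omega]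
  rfl

theorem adjSwap_comm {k l : ℕ} (h : k + 2 ≤ l) :
    adjSwap n k * adjSwap n l = adjSwap n l * adjSwap n k := by
  by_cases hl : l + 1 < n
  · rw [adjSwap_eq hl, simpleRefl, Equiv.mul_swap_eq_swap_mul,
      adjSwap_apply_of_ne _ (by omega) (by omega),
      adjSwap_apply_of_ne _ (by omega) (by omega)]
  · simp [adjSwap, hl]

theorem adjSwap_braid {k : ℕ} (h : k + 2 < n) :
    adjSwap n k * adjSwap n (k + 1) * adjSwap n k =
      adjSwap n (k + 1) * adjSwap n k * adjSwap n (k + 1) := by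
  have h1 : adjSwap n k * adjSwap n (k + 1) =
      Equiv.swap ⟨k, by omega⟩ ⟨k + 2, h⟩ * adjSwap n k := by
    rw [adjSwap_eq (show k + 1 + 1 < n from h), simpleRefl, Equiv.mul_swap_eq_swap_mul,
      adjSwap_apply_right (show k + 1 < n by omega), adjSwap_apply_of_ne _ (by omega) (by omega)]
  have h2 : adjSwap n (k + 1) * adjSwap n k =
      Equiv.swap ⟨k, by omega⟩ ⟨k + 2, h⟩ * adjSwap n (k + 1) := by
    rw [adjSwap_eq (show k + 1 < n by omega), simpleRefl, Equiv.mul_swap_eq_swap_mul,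
      adjSwap_apply_left (show k + 1 + 1 < n from h), adjSwap_apply_of_ne _ (by omega) (by omega)]
  rw [h1, h2, mul_adjSwap_mul_adjSwap, mul_adjSwap_mul_adjSwap]

theorem isDescent_mul_adjSwap_of_far (w : Equiv.Perm (Fin n)) {k l : ℕ}
    (h : k + 2 ≤ l ∨ l + 2 ≤ k) : IsDescent (w * adjSwap n k) l ↔ IsDescent w l := by
  unfold IsDescent
  refine exists_congr fun hl => ?_
  rw [Equiv.Perm.mul_apply, Equiv.Perm.mul_apply, adjSwap_apply_of_ne _ (by omega) (by omega),
    adjSwap_apply_of_ne _ (by omega) (by omega)]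

/-- Both sides of the braid relation vanish at `w` unless its values at `k`, `k + 1`, `k + 2`
decrease, and then both evaluate `f` at the same permutation. If `k + 2` is out of range, `nilOp n R
(k + 1)` is zero. -/
theorem nilCoxeterRel_nilOp : NilCoxeterRel (nilOp n R) := by
  refine ⟨fun k => ?_, fun k l hkl => ?_, fun k => ?_⟩
  · refine LinearMap.ext fun f => funext fun w => ?_
    rw [Module.End.mul_apply]
    by_cases h : IsDescent w k
    · rw [nilOp_apply_of_isDescent h, nilOp_apply_of_not_isDescent h.mul_adjSwap.not_isDescent]
      rfl
    · rw [nilOp_apply_of_not_isDescent h]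
      rfl
  · refine LinearMap.ext fun f => funext fun w => ?_
    rw [Module.End.mul_apply, Module.End.mul_apply]
    have hk := isDescent_mul_adjSwap_of_far w (k := l) (l := k) (Or.inr hkl)
    have hl := isDescent_mul_adjSwap_of_far w (k := k) (l := l) (Or.inl hkl)
    by_cases h1 : IsDescent w k <;> by_cases h2 : IsDescent w l
    · rw [nilOp_apply_of_isDescent h1, nilOp_apply_of_isDescent h2,
        nilOp_apply_of_isDescent (hl.2 h2), nilOp_apply_of_isDescent (hk.2 h1), mul_assoc,
        mul_assoc, adjSwap_comm hkl]
    · rw [nilOp_apply_of_isDescent h1, nilOp_apply_of_not_isDescent h2,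
        nilOp_apply_of_not_isDescent (mt hl.1 h2)]
    · rw [nilOp_apply_of_not_isDescent h1, nilOp_apply_of_isDescent h2,
        nilOp_apply_of_not_isDescent (mt hk.1 h1)]
    · rw [nilOp_apply_of_not_isDescent h1, nilOp_apply_of_not_isDescent h2]
  · by_cases hn : k + 2 < n
    · refine LinearMap.ext fun f => funext fun w => ?_
      simp only [Module.End.mul_apply]
      have hk : k + 1 < n := by omega
      have e1 : adjSwap n k ⟨k, by omega⟩ = ⟨k + 1, hk⟩ := adjSwap_apply_left hk
      have e2 : adjSwap n k ⟨k + 1, hk⟩ = ⟨k, by omega⟩ := adjSwap_apply_right hk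
      have e3 : adjSwap n k ⟨k + 2, hn⟩ = ⟨k + 2, hn⟩ :=
        adjSwap_apply_of_ne hn (by omega) (by omega)
      have e4 : adjSwap n (k + 1) ⟨k, by omega⟩ = ⟨k, by omega⟩ :=
        adjSwap_apply_of_ne _ (by omega) (by omega)
      have e5 : adjSwap n (k + 1) ⟨k + 1, hk⟩ = ⟨k + 2, hn⟩ := adjSwap_apply_left (k := k + 1) hn
      have e6 : adjSwap n (k + 1) ⟨k + 2, hn⟩ = ⟨k + 1, hk⟩ := adjSwap_apply_right (k := k + 1) hn
      have d1 : ∀ v : Equiv.Perm (Fin n),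
          IsDescent v k ↔ v ⟨k + 1, hk⟩ < v ⟨k, by omega⟩ :=
        fun v => ⟨fun h => h.2, fun h => ⟨hk, h⟩⟩
      have d2 : ∀ v : Equiv.Perm (Fin n),
          IsDescent v (k + 1) ↔ v ⟨k + 2, hn⟩ < v ⟨k + 1, hk⟩ :=
        fun v => ⟨fun h => h.2, fun h => ⟨hn, h⟩⟩
      have hb : w * adjSwap n k * adjSwap n (k + 1) * adjSwap n k =
          w * adjSwap n (k + 1) * adjSwap n k * adjSwap n (k + 1) := by
        have := congrArg (w * ·) (adjSwap_braid hn)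
        simpa only [← mul_assoc] using this
      simp only [nilOp, LinearMap.coe_mk, AddHom.coe_mk, d1, d2, Equiv.Perm.mul_apply, e1, e2, e3,
        e4, e5, e6, hb]
      by_cases h1 : w ⟨k + 1, hk⟩ < w ⟨k, by omega⟩ <;>
        by_cases h2 : w ⟨k + 2, hn⟩ < w ⟨k + 1, hk⟩
      · simp [h1, h2]
      · simp [h1, h2]
      · simp [h1, h2]
      · simp [h1, h2]
    · rw [nilOp_eq_zero (show n ≤ k + 1 + 1 by omega)]
      simp

theorem rowProd_nilOp_succ (x : R) {m d : ℕ} (h : n ≤ m + d + 1) :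
    rowProd (nilOp n R) x m (d + 1) = rowProd (nilOp n R) x m d := by
  rw [rowProd_succ_right, nilOp_eq_zero h, smul_zero, add_zero, mul_one]

/-- Factors with out-of-range index are `1`, so the number of factors can stay `n` when the starting
index shifts. -/
theorem rowProd_nilOp_unfold (x : R) (m : ℕ) :
    rowProd (nilOp n R) x m n =
      (1 + x • nilOp n R m) * rowProd (nilOp n R) x (m + 1) n := by
  rw [← rowProd_nilOp_succ x (show n ≤ m + n + 1 by omega), rowProd]

theorem nilOp_map (φ : R →+* R) (k : ℕ) (f : Equiv.Perm (Fin n) → R) (w : Equiv.Perm (Fin n)) :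
    φ (nilOp n R k f w) = nilOp n R k (fun v => φ (f v)) w := by
  by_cases h : IsDescent w k
  · rw [nilOp_apply_of_isDescent h, nilOp_apply_of_isDescent h]
  · rw [nilOp_apply_of_not_isDescent h, nilOp_apply_of_not_isDescent h, map_zero]

theorem rowProd_nilOp_map (φ : R →+* R) (x : R) (m d : ℕ) (f : Equiv.Perm (Fin n) → R)
    (w : Equiv.Perm (Fin n)) :
    φ (rowProd (nilOp n R) x m d f w) =
      rowProd (nilOp n R) (φ x) m d (fun v => φ (f v)) w := by
  induction d generalizing m w with
  | zero => rfl
  | succ d ih =>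
    have h := funext fun v => ih (m + 1) v
    simp only [rowProd, Module.End.mul_apply, LinearMap.add_apply, Module.End.one_apply,
      LinearMap.smul_apply, Pi.add_apply, Pi.smul_apply, smul_eq_mul, map_add, map_mul]
    rw [nilOp_map, ih, h]

/-- The operator applied first stands rightmost in a composition, so reading a row from right to
left gives factors with increasing indices. -/
theorem foldl_range_reverse_eq_rowProd (x : R) (m d : ℕ) (f : Equiv.Perm (Fin n) → R) :
    (List.range d).reverse.foldl (fun g j => g + x • nilOp n R (m + j) g) f =
      rowProd (nilOp n R) x m d f := by
  induction d generalizing f with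
  | zero => rfl
  | succ d ih =>
    rw [List.range_succ, List.reverse_append, List.reverse_singleton, List.singleton_append,
      List.foldl_cons, ih, rowProd_succ_right]
    rfl

open scoped Classical in
/-- The coefficients of `∏_c (1 + x_c u_{f(c)})` enumerate reduced subwords. -/
theorem foldl_nilOp_eq_sum {α : Type*} [DecidableEq α] (f : α → ℕ) (x : α → R) (L : List α)
    (hL : L.Nodup) (v : Equiv.Perm (Fin n)) :
    L.foldl (fun g c => g + x c • nilOp n R (f c) g) (Pi.single 1 1) v =
      ∑ P ∈ L.toFinset.powerset,
        if IsReducedWord ((L.filter fun c => c ∈ P).map f) v then ∏ c ∈ P, x c else 0 := by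
  classical
  induction L using List.reverseRecOn generalizing v with
  | nil =>
    by_cases hv : v = 1
    · subst hv
      simp [IsReducedWord]
    · have : ¬ IsReducedWord ([] : List ℕ) v := fun h => hv h.1.symm
      simp [hv, this]
  | append_singleton L c ih =>
    rw [List.nodup_append] at hL
    have hc : c ∉ L := fun h => hL.2.2 c h c (List.mem_singleton_self c) rfl
    have hfin : (L ++ [c]).toFinset = insert c L.toFinset := by
      ext a
      simp
    -- The summands `g` and `x c • nilOp g` of the last step correspond to the subsets without and
    -- with the last letter.
    rw [hfin, Finset.sum_powerset_insert (by simpa using hc), List.foldl_append, List.foldl_cons,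
      List.foldl_nil, Pi.add_apply, Pi.smul_apply, ih hL.1, smul_eq_mul]
    congr 1
    · refine Finset.sum_congr rfl fun P hP => ?_
      have hcP : c ∉ P := fun h => hc (by simpa using Finset.mem_powerset.1 hP h)
      have : (L ++ [c]).filter (fun a => a ∈ P) = L.filter fun a => a ∈ P := by
        simp [List.filter_append, hcP]
      simp only [this]
    · have hw : ∀ P ∈ L.toFinset.powerset,
          ((L ++ [c]).filter fun a => a ∈ insert c P).map f =
            ((L.filter fun a => a ∈ P).map f) ++ [f c] := by
        intro P _
        have : (L.filter fun a => a ∈ insert c P) = L.filter fun a => a ∈ P := by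
          refine List.filter_congr fun a ha => ?_
          have : a ≠ c := fun h => hc (h ▸ ha)
          simp [this]
        rw [List.filter_append, this]
        simp
      have hprod : ∀ P ∈ L.toFinset.powerset, ∏ a ∈ insert c P, x a = x c * ∏ a ∈ P, x a := by
        intro P hP
        exact Finset.prod_insert fun h => hc (by simpa using Finset.mem_powerset.1 hP h)
      by_cases hd : IsDescent v (f c)
      · rw [nilOp_apply_of_isDescent hd, ih hL.1, Finset.mul_sum]
        refine Finset.sum_congr rfl fun P hP => ?_
        simp only [hw P hP, hprod P hP, isReducedWord_append_singleton, hd, true_and]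
        split_ifs <;> simp
      · rw [nilOp_apply_of_not_isDescent hd, mul_zero]
        refine (Finset.sum_eq_zero fun P hP => ?_).symm
        simp only [hw P hP, isReducedWord_append_singleton, hd, false_and, if_false]

end NilOp

/-! ### Schubert polynomials as generating functions of reduced subwords -/

section PipeDream

variable {n : ℕ}

open MvPolynomial

/-- The generating function of the reduced words for `v` in the square word. -/
noncomputable def pipeSum (v : Equiv.Perm (Fin n)) : MvPolynomial (Fin n) ℤ :=
  (readingOrder n).foldl
    (fun g c => g + (X c.1 : MvPolynomial (Fin n) ℤ) •
      nilOp n (MvPolynomial (Fin n) ℤ) ((c.1 : ℕ) + (c.2 : ℕ)) g) (Pi.single 1 1) v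

theorem faceWeight_compl (P : Finset (Fin n × Fin n)) :
    faceWeight Pᶜ = ∏ c ∈ P, (X c.1 : MvPolynomial (Fin n) ℤ) := by
  classical
  unfold faceWeight
  have h : ∏ c ∈ P, (X c.1 : MvPolynomial (Fin n) ℤ) = ∏ c, if c ∈ P then X c.1 else 1 := by
    simp
  rw [compl_compl, h, Fintype.prod_prod_type]
  refine Finset.prod_congr rfl fun i _ => ?_
  rw [← Finset.prod_filter]
  exact (Finset.prod_const _).symm

open scoped Classical in
theorem pipeSum_eq_sum_words (v : Equiv.Perm (Fin n)) :
    pipeSum v = ∑ P : Finset (Fin n × Fin n),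
      if IsReducedWord (boxWord P) v then faceWeight Pᶜ else 0 := by
  unfold pipeSum
  rw [foldl_nilOp_eq_sum (fun c : Fin n × Fin n => (c.1 : ℕ) + (c.2 : ℕ))
    (fun c => (X c.1 : MvPolynomial (Fin n) ℤ)) _ nodup_readingOrder]
  have h : (readingOrder n).toFinset.powerset = Finset.univ := by
    ext P
    simp [Finset.subset_iff, mem_readingOrder]
  rw [h]
  refine Finset.sum_congr rfl fun P _ => ?_
  rw [faceWeight_compl]
  rfl

open scoped Classical in
theorem pipeSum_eq_sum_faces (v : Equiv.Perm (Fin n)) :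
    pipeSum v = ∑ F ∈ Finset.univ.filter fun F : Finset (Fin n × Fin n) =>
      IsReducedWord (boxWord Fᶜ) v, faceWeight F := by
  rw [pipeSum_eq_sum_words, Finset.sum_filter,
    ← Equiv.sum_comp (Function.Involutive.toPerm compl compl_involutive)]
  refine Finset.sum_congr rfl fun F _ => ?_
  simp

/-- The partial products of the rows of the square word. -/
noncomputable def rowsProd (n : ℕ) : ℕ → Equiv.Perm (Fin n) → MvPolynomial (Fin n) ℤ
  | 0 => Pi.single 1 1
  | m + 1 => rowProd (nilOp n (MvPolynomial (Fin n) ℤ))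
      (if h : m < n then (X ⟨m, h⟩ : MvPolynomial (Fin n) ℤ) else 0) m n (rowsProd n m)

theorem pipeSum_eq_rowsProd (v : Equiv.Perm (Fin n)) : pipeSum v = rowsProd n n v := by
  have h1 : ∀ m, (List.range m).foldl (fun g i =>
      rowProd (nilOp n (MvPolynomial (Fin n) ℤ))
        (if h : i < n then (X ⟨i, h⟩ : MvPolynomial (Fin n) ℤ) else 0) i n g) (Pi.single 1 1) =
      rowsProd n m := by
    intro m
    induction m with
    | zero => rfl
    | succ m ih => rw [List.range_succ, List.foldl_append, ih]; rfl
  have h2 := h1 n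
  rw [← List.map_coe_finRange_eq_range, List.foldl_map] at h2
  rw [← h2, pipeSum, readingOrder, List.foldl_flatMap]
  refine congrFun (congrFun (congrFun (congrArg _ ?_) _) _) v
  funext g i
  rw [List.foldl_map, dif_pos i.isLt, ← foldl_range_reverse_eq_rowProd,
    ← List.map_coe_finRange_eq_range, ← List.map_reverse, List.foldl_map]

theorem rowsProd_invariant {φ : MvPolynomial (Fin n) ℤ →+* MvPolynomial (Fin n) ℤ} {m : ℕ}
    (h : ∀ i : Fin n, (i : ℕ) < m → φ (X i) = X i) (v : Equiv.Perm (Fin n)) :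
    φ (rowsProd n m v) = rowsProd n m v := by
  induction m generalizing v with
  | zero =>
    by_cases hv : v = 1
    · subst hv
      simp [rowsProd]
    · simp [rowsProd, hv]
  | succ m ih =>
    have ih' := funext fun v => ih (fun i hi => h i (by omega)) v
    rw [rowsProd, rowProd_nilOp_map, ih']
    split_ifs with hm
    · rw [h _ (Nat.lt_succ_self m)]
    · rw [map_zero]

/-- The total product splits off a factor `1 - x_{k+1} u_k` from a function whose values are
symmetric in the variables `x_k` and `x_{k+1}`. -/
theorem exists_symmetric_factor {k : ℕ} (hk : k + 1 < n) {m : ℕ} (hm : k + 2 ≤ m) :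
    ∃ H : Equiv.Perm (Fin n) → MvPolynomial (Fin n) ℤ,
      (∀ v, rename (Equiv.swap (⟨k, Nat.lt_of_succ_lt hk⟩ : Fin n) ⟨k + 1, hk⟩) (H v) = H v) ∧
      rowsProd n m = (1 - (X ⟨k + 1, hk⟩ : MvPolynomial (Fin n) ℤ) •
        nilOp n (MvPolynomial (Fin n) ℤ) k) H := by
  set a : Fin n := ⟨k, Nat.lt_of_succ_lt hk⟩ with ha
  set b : Fin n := ⟨k + 1, hk⟩ with hb
  set φ : MvPolynomial (Fin n) ℤ →+* MvPolynomial (Fin n) ℤ :=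
    (rename (R := ℤ) (Equiv.swap a b)).toRingHom with hφ
  have hφX : ∀ i, φ (X i) = X (Equiv.swap a b i) := fun i => rename_X _ _
  have hφi : ∀ i : Fin n, (i : ℕ) ≠ k → (i : ℕ) ≠ k + 1 → φ (X i) = X i := by
    intro i h1 h2
    rw [hφX, Equiv.swap_apply_of_ne_of_ne]
    · simpa [ha, Fin.ext_iff] using h1
    · simpa [hb, Fin.ext_iff] using h2
  have hrel := nilCoxeterRel_nilOp (n := n) (R := MvPolynomial (Fin n) ℤ)
  induction m, hm using Nat.le_induction with
  | base =>
    -- Row `k + 1` starts at index `k + 1`. Completed by the factor of index `k`, it has the same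
    -- shape as row `k`; the two then commute, and the price is the inverse factor `1 - x_{k+1}
    -- u_k`.
    set B := fun x : MvPolynomial (Fin n) ℤ => rowProd (nilOp n (MvPolynomial (Fin n) ℤ)) x k n
      with hB
    refine ⟨B (X b) (B (X a) (rowsProd n k)), fun v => ?_, ?_⟩
    · change φ _ = _
      have h0 := funext fun v => rowsProd_invariant (φ := φ) (m := k)
        (fun i hi => hφi i (by omega) (by omega)) v
      have h1 : (fun v => φ (B (X a) (rowsProd n k) v)) = B (X b) (rowsProd n k) := by
        funext v
        rw [hB, rowProd_nilOp_map, h0, hφX, Equiv.swap_apply_left]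
      rw [hB, rowProd_nilOp_map, ← hB, h1, hφX, Equiv.swap_apply_right]
      have h2 := hrel.rowProd_comm (X a : MvPolynomial (Fin n) ℤ) (X b) k n
      have h3 := congrArg (fun T => T (rowsProd n k)) h2
      exact congrFun h3 v
    · have h1 : rowsProd n (k + 1) = B (X a) (rowsProd n k) := by
        rw [rowsProd, dif_pos (show k < n by omega)]
      rw [rowsProd, dif_pos hk, h1, hB]
      dsimp only
      have h2 := congrArg
        (· * rowProd (nilOp n (MvPolynomial (Fin n) ℤ)) (X b : MvPolynomial (Fin n) ℤ) (k + 1) n)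
        (one_add_smul_mul_one_sub (hrel.sq k) (X b : MvPolynomial (Fin n) ℤ)).2
      rw [one_mul, mul_assoc, ← rowProd_nilOp_unfold] at h2
      rw [← h2]
      rfl
  | succ m hm ih =>
    obtain ⟨H, hH, hrow⟩ := ih
    have hH' : (fun v => φ (H v)) = H := funext hH
    set x : MvPolynomial (Fin n) ℤ := if h : m < n then X ⟨m, h⟩ else 0 with hx
    refine ⟨rowProd (nilOp n (MvPolynomial (Fin n) ℤ)) x m n H, fun v => ?_, ?_⟩
    · change φ _ = _
      rw [rowProd_nilOp_map, hH']
      have hφx : φ x = x := by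
        rw [hx]
        split_ifs with h
        · exact hφi _ (by dsimp only; omega) (by dsimp only; omega)
        · exact map_zero φ
      rw [hφx]
    · rw [rowsProd, hrow, ← Module.End.mul_apply, ← Module.End.mul_apply]
      -- Row `m ≥ k + 2` only involves operators of index at least `k + 2`, which commute with
      -- `u_k`.
      have hc : Commute (1 - (X b : MvPolynomial (Fin n) ℤ) •
          nilOp n (MvPolynomial (Fin n) ℤ) k) (rowProd (nilOp n (MvPolynomial (Fin n) ℤ)) x m n) :=
        Commute.sub_left (Commute.one_left _)
          (Commute.smul_left (hrel.commute_rowProd x hm n) _)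
      rw [hc.eq]

/-- The divided differences of the generating functions. -/
theorem pipeSum_sub_rename {k : ℕ} (hk : k + 1 < n) {v : Equiv.Perm (Fin n)}
    (hv : IsDescent v k) :
    pipeSum v - rename (Equiv.swap (⟨k, by omega⟩ : Fin n) ⟨k + 1, hk⟩) (pipeSum v) =
      (X ⟨k, by omega⟩ - X ⟨k + 1, hk⟩) * pipeSum (v * adjSwap n k) := by
  obtain ⟨H, hH, hrow⟩ := exists_symmetric_factor hk (m := n) (by omega)
  have h1 : ∀ w, pipeSum w = H w - X ⟨k + 1, hk⟩ *
      nilOp n (MvPolynomial (Fin n) ℤ) k H w := by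
    intro w
    rw [pipeSum_eq_rowsProd, hrow]
    rfl
  rw [h1 v, h1 (v * adjSwap n k), nilOp_apply_of_isDescent hv,
    nilOp_apply_of_not_isDescent hv.mul_adjSwap.not_isDescent, map_sub, map_mul, rename_X, hH, hH,
    Equiv.swap_apply_right]
  ring

theorem pipeSum_eq_dividedDiff {k : ℕ} (hk : k + 1 < n) {w : Equiv.Perm (Fin n)}
    (hw : IsAscent w k) :
    pipeSum w = dividedDiff ⟨k, by omega⟩ ⟨k + 1, hk⟩ (pipeSum (w * adjSwap n k)) := by
  have h1 := pipeSum_sub_rename hk hw.mul_adjSwap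
  rw [mul_adjSwap_mul_adjSwap, dividedDiff_spec] at h1
  have hne : (X ⟨k, by omega⟩ - X ⟨k + 1, hk⟩ : MvPolynomial (Fin n) ℤ) ≠ 0 := by
    rw [sub_ne_zero]
    intro h
    simpa using X_injective h
  exact (mul_left_cancel₀ hne h1).symm

/-! ### Nonvanishing, the longest element, and Schubert polynomials -/

theorem pipeSum_one : pipeSum (1 : Equiv.Perm (Fin n)) = 1 := by
  have h : ∀ (L : List (Fin n × Fin n)) (g : Equiv.Perm (Fin n) → MvPolynomial (Fin n) ℤ),
      L.foldl (fun g c => g + (X c.1 : MvPolynomial (Fin n) ℤ) •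
        nilOp n (MvPolynomial (Fin n) ℤ) ((c.1 : ℕ) + (c.2 : ℕ)) g) g 1 = g 1 := by
    intro L
    induction L with
    | nil => exact fun _ => rfl
    | cons c L ih =>
      intro g
      have hd : ¬ IsDescent (1 : Equiv.Perm (Fin n)) ((c.1 : ℕ) + (c.2 : ℕ)) := by
        rintro ⟨_, h⟩
        simp [Fin.lt_def] at h
      rw [List.foldl_cons, ih, Pi.add_apply, Pi.smul_apply, nilOp_apply_of_not_isDescent hd,
        smul_zero, add_zero]
  rw [pipeSum, h, Pi.single_eq_same]

theorem eq_one_of_forall_not_isDescent {w : Equiv.Perm (Fin n)} (h : ∀ k, ¬ IsDescent w k) :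
    w = 1 := by
  rcases n with _ | n
  · exact Subsingleton.elim _ _
  have hmono : StrictMono w := by
    refine Fin.strictMono_iff_lt_succ.2 fun i => ?_
    rcases isAscent_or_isDescent w (k := i) (by omega) with h1 | h1
    · exact h1.2
    · exact absurd h1 (h _)
  refine Equiv.ext fun i => ?_
  have := (StrictMono.range_inj hmono strictMono_id).1 (by simp)
  rw [this]
  rfl

/-- At a descent, `pipeSum w = 0` would force `pipeSum (w s_k) = 0` by the divided difference
recursion; descending in length ends at the identity, where the value is `1`. -/
theorem pipeSum_ne_zero (w : Equiv.Perm (Fin n)) : pipeSum w ≠ 0 := by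
  by_cases h : ∃ k, IsDescent w k
  · obtain ⟨k, hk⟩ := h
    have hlt : permLength (w * adjSwap n k) < permLength w := by
      rw [← hk.permLength_mul]
      omega
    have ih := pipeSum_ne_zero (w * adjSwap n k)
    rw [pipeSum_eq_dividedDiff hk.1 hk.mul_adjSwap, mul_adjSwap_mul_adjSwap] at ih
    intro h0
    have h1 := pipeSum_sub_rename hk.1 hk
    rw [pipeSum_eq_dividedDiff hk.1 hk.mul_adjSwap, mul_adjSwap_mul_adjSwap, h0, map_zero, sub_zero,
      eq_comm, mul_eq_zero, sub_eq_zero] at h1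
    rcases h1 with h1 | h1
    · simpa using X_injective h1
    · rw [h0] at ih
      exact ih h1
  · push Not at h
    rw [eq_one_of_forall_not_isDescent h, pipeSum_one]
    exact one_ne_zero
termination_by permLength w

theorem exists_isReducedWord (v : Equiv.Perm (Fin n)) :
    ∃ P : Finset (Fin n × Fin n), IsReducedWord (boxWord P) v := by
  classical
  by_contra h
  push Not at h
  refine pipeSum_ne_zero v ?_
  rw [pipeSum_eq_sum_words]
  exact Finset.sum_eq_zero fun P _ => if_neg (h P)

/-- The boxes strictly above the antidiagonal. -/
def staircase (n : ℕ) : Finset (Fin n × Fin n) :=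
  Finset.univ.filter fun c => (c.1 : ℕ) + (c.2 : ℕ) + 1 < n

/-- Letters of a reduced word are in range, so `P` lies in the staircase, and comparing
cardinalities gives equality. That the staircase itself is reduced follows because some reduced word
exists. -/
theorem isReducedWord_boxWord_iff_eq_staircase {w : Equiv.Perm (Fin n)}
    (hw : ∀ k, ¬ IsAscent w k) (P : Finset (Fin n × Fin n)) :
    IsReducedWord (boxWord P) w ↔ P = staircase n := by
  have hanti : StrictAnti w := by
    rcases n with _ | n
    · exact fun a => a.elim0
    refine Fin.strictAnti_iff_succ_lt.2 fun i => ?_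
    rcases isAscent_or_isDescent w (k := i) (by omega) with h1 | h1
    · exact absurd h1 (hw _)
    · exact h1.2
  have hcard : (staircase n).card = permLength w := by
    unfold permLength staircase
    -- Reversing the column turns `i + j + 1 < n` into `i < j`, and every such pair is an inversion
    -- of the decreasing `w`.
    refine Finset.card_bij' (fun c _ => (c.1, c.2.rev)) (fun c _ => (c.1, c.2.rev)) ?_ ?_ ?_ ?_
    · rintro ⟨i, j⟩ h
      rw [Finset.mem_filter] at h ⊢
      have hlt : i < j.rev := by
        rw [Fin.lt_def, Fin.val_rev]
        have := h.2
        dsimp only at this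
        omega
      exact ⟨Finset.mem_univ _, hlt, hanti hlt⟩
    · rintro ⟨i, j⟩ h
      rw [Finset.mem_filter] at h ⊢
      refine ⟨Finset.mem_univ _, ?_⟩
      have := h.2.1
      dsimp only at this ⊢
      rw [Fin.lt_def] at this
      rw [Fin.val_rev]
      omega
    · rintro ⟨i, j⟩ _
      simp
    · rintro ⟨i, j⟩ _
      simp
  have key : ∀ P, IsReducedWord (boxWord P) w → P = staircase n := by
    intro P hP
    refine Finset.eq_of_subset_of_card_le (fun c hc => ?_) ?_
    · refine Finset.mem_filter.2 ⟨Finset.mem_univ _, hP.lt _ ?_⟩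
      exact List.mem_map.2 ⟨c, List.mem_filter.2 ⟨mem_readingOrder c, by simpa using hc⟩, rfl⟩
    · rw [hcard, ← hP.2, length_boxWord]
  refine ⟨key P, ?_⟩
  rintro rfl
  obtain ⟨Q, hQ⟩ := exists_isReducedWord w
  rwa [key Q hQ] at hQ

theorem pipeSum_of_forall_not_isAscent {w : Equiv.Perm (Fin n)} (hw : ∀ k, ¬ IsAscent w k) :
    pipeSum w = ∏ i : Fin n, X i ^ (n - 1 - (i : ℕ)) := by
  classical
  rw [pipeSum_eq_sum_words]
  simp only [isReducedWord_boxWord_iff_eq_staircase hw, Finset.sum_ite_eq', Finset.mem_univ,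
    if_true]
  unfold faceWeight
  refine Finset.prod_congr rfl fun i _ => ?_
  congr 1
  have h : (Finset.univ.filter fun j : Fin n => (i, j) ∈ (staircase n)ᶜᶜ) =
      Finset.univ.filter fun j : Fin n => (j : ℕ) < n - 1 - (i : ℕ) := by
    ext j
    simp only [compl_compl, staircase, Finset.mem_filter, Finset.mem_univ, true_and]
    omega
  rw [h, Fin.card_filter_val_lt]
  omega

/-- The divided difference identity for `pipeSum` holds at every ascent, so the particular ascent
chosen in `schubert` is immaterial. The number of all pairs of positions bounds the length and makes
the upward recursion terminate. -/
theorem schubert_eq_pipeSum (w : Equiv.Perm (Fin n)) : schubert w = pipeSum w := by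
  rw [schubert]
  split_ifs with h
  · have hasc : IsAscent w h.choose := h.choose_spec
    have h1 := hasc.permLength_mul
    have h2 : permLength (w * adjSwap n h.choose) ≤ Fintype.card (Fin n × Fin n) :=
      Finset.card_le_univ _
    rw [← adjSwap_eq h.choose_spec.1, schubert_eq_pipeSum (w * adjSwap n h.choose)]
    exact (pipeSum_eq_dividedDiff _ hasc).symm
  · exact (pipeSum_of_forall_not_isAscent fun k hk => h ⟨k, hk⟩).symm
termination_by Fintype.card (Fin n × Fin n) - permLength w
decreasing_by omega

open scoped Classical in
-- The sets of faces attached to different `v` are disjoint, because a box set determines its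
-- Demazure product.
theorem sum_schubert_eq_sum_faceWeight (S : Finset (Equiv.Perm (Fin n)))
    {Δ : Finset (Finset (Fin n × Fin n))}
    (h : ∀ F, F ∈ Δ ↔ ∃ v ∈ S, IsReducedWord (boxWord Fᶜ) v) :
    ∑ w ∈ S, schubert w = ∑ F ∈ Δ, faceWeight F := by
  have hΔ : Δ = S.biUnion fun v => Finset.univ.filter fun F : Finset (Fin n × Fin n) =>
      IsReducedWord (boxWord Fᶜ) v := by
    ext F
    simp [h]
  rw [hΔ, Finset.sum_biUnion]
  · exact Finset.sum_congr rfl fun w _ => by rw [schubert_eq_pipeSum, pipeSum_eq_sum_faces]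
  · intro v _ w _ hvw
    refine Finset.disjoint_left.2 fun F hv hw => hvw ?_
    rw [Finset.mem_filter] at hv hw
    exact hv.2.1.symm.trans hw.2.1

end PipeDream

end AsmSchubert

theorem mainTheorem8 {n : ℕ} (A : Matrix (Fin n) (Fin n) ℤ) (hA : IsASM A) :
    (∑ w ∈ permSet A, schubert w = ∑ F ∈ facets (asmComplex A), faceWeight F) ∧
    (∑ w ∈ minPermSet A, schubert w = ∑ F ∈ maxFacets (asmComplex A), faceWeight F) :=
  ⟨sum_schubert_eq_sum_faceWeight _ fun _ => hA.mem_facets_iff,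
    sum_schubert_eq_sum_faceWeight _ fun _ => hA.mem_maxFacets_iff exists_isReducedWord⟩
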